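/- All probabilities are uniform. An $n$-variable randomized decision tree (RDT) $R$ is a binary tree whose internal nodes are decision nodes (branching on a bit $x_i$ of the input $x\in\{0,1\}^n$) or stochastic nodes (branching on a fair coin), and whose leaves carry rational labels in $[0,1]$. Its query complexity $q$ and its randomness complexity $m$ are the maximum numbers of decision nodes and of stochastic nodes on a root-to-leaf path; $R(x,r)$ is the label reached on input $x$ with coins $r\in\{0,1\}^m$, and $\mu_R(x)=\mathbb{E}_{r\sim\{0,1\}^m}[R(x,r)]$ is its mean function. Its description length $N$ is the length of its description, with all numbers written in binary. **Theorem (online derandomization).** There is a single deterministic algorithm $\mathcal{A}$ with the following guarantee. It is given the description of an RDT $R$ with $n$ variables, query complexity $q$ and description length $N$, an error parameter $\varepsilon\in(0,\tfrac12)$ (a real number whose binary digits it can read), and query access to a string $x\in\{0,1\}^n$. For all such $n$, $R$, $\varepsilon$ and every $x$, it runs in time $\mathrm{poly}(N,q,1/\varepsilon)$, makes $O(q^2/\varepsilon^3)$ queries to $x$, and returns a value $\mathcal{A}(x)\in[0,1]$ (as a fraction). The polynomial and the constant in $O(\cdot)$ are absolute. For every $n$, $R$ and $\varepsilon$ the returned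 values satisfy $$\mathbb{E}_{x\sim\{0,1\}^n}\Big[\big(\mathcal{A}(x)-\mu_R(x)\big)^2\Big]\le\varepsilon .$$ Here an algorithm is a program of a first-order functional language over binary trees (pure LISP with pairing, case distinction, local definitions, recursive functions, input queries and reads of digits of $\varepsilon$), and its running time is the number of evaluation steps, a measure polynomially equivalent to Turing machine time. -/

import Mathlib

open scoped BigOperators

namespace QueryDerand

/-! ### Randomized decision trees -/

/-- An `n`-variable randomized decision tree: leaves labelled by (rational) values in `[0,1]`,
decision nodes branching on a variable `x_i`, and stochastic nodes branching on a fair coin.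
In both kinds of node the first subtree is the `0`-branch, the second one the `1`-branch. -/
inductive RDT (n : ℕ) : Type
  | leaf (l : ℚ) (nonneg : 0 ≤ l) (le_one : l ≤ 1) : RDT n
  | decision (i : Fin n) (R₀ R₁ : RDT n) : RDT n
  | stochastic (R₀ R₁ : RDT n) : RDT n

/-- The maximum number of decision nodes on a root-to-leaf path. -/
def RDT.queryComplexity {n : ℕ} : RDT n → ℕ
  | .leaf _ _ _ => 0
  | .decision _ R₀ R₁ => max R₀.queryComplexity R₁.queryComplexity + 1
  | .stochastic R₀ R₁ => max R₀.queryComplexity R₁.queryComplexity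

/-- The maximum number of stochastic nodes on a root-to-leaf path. -/
def RDT.randomnessComplexity {n : ℕ} : RDT n → ℕ
  | .leaf _ _ _ => 0
  | .decision _ R₀ R₁ => max R₀.randomnessComplexity R₁.randomnessComplexity
  | .stochastic R₀ R₁ => max R₀.randomnessComplexity R₁.randomnessComplexity + 1

/-- The output `R(x, r)`; the `j`-th stochastic node met on the path reads the coin `r j`. -/
def RDT.run {n : ℕ} (x : Fin n → Bool) : RDT n → (ℕ → Bool) → ℝ
  | .leaf l _ _, _ => (l : ℝ)
  | .decision i R₀ R₁, r => if x i then R₁.run x r else R₀.run x r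
  | .stochastic R₀ R₁, r =>
      if r 0 then R₁.run x (fun j => r (j + 1)) else R₀.run x (fun j => r (j + 1))

/-- A bit string of length `n` as a sequence of bits, padded with `0`. -/
def padBits {n : ℕ} (x : Fin n → Bool) (i : ℕ) : Bool :=
  if h : i < n then x ⟨i, h⟩ else false

/-- The mean function `μ_R(x) = E_r[R(x, r)]`, where `r ∈ {0,1}^m` is uniform and `m` is the
randomness complexity of `R`. -/
noncomputable def RDT.mean {n : ℕ} (R : RDT n) (x : Fin n → Bool) : ℝ :=
  𝔼 r : Fin R.randomnessComplexity → Bool, R.run x (padBits r)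

/-! ### Data and descriptions -/

/-- The data of the machine model: binary trees (S-expressions over the single atom `nil`). -/
inductive Val : Type
  | nil : Val
  | cons (a b : Val) : Val

/-- The size of a datum: its number of nodes. -/
def Val.size : Val → ℕ
  | .nil => 1
  | .cons a b => a.size + b.size + 1

def Val.ofBool : Bool → Val
  | false => .nil
  | true => .cons .nil .nil

/-- A list of bits, as a `nil`-terminated list. -/
def Val.ofBits : List Bool → Val
  | [] => .nil
  | b :: l => .cons (Val.ofBool b) (Val.ofBits l)

/-- A natural number in binary, least significant bit first. -/
def Val.ofNat (k : ℕ) : Val := Val.ofBits k.bits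

/-- The natural number that a datum denotes, read as a list of bits (`nil` is the bit `0`, anything
else the bit `1`), least significant bit first. -/
def Val.toNat : Val → ℕ
  | .nil => 0
  | .cons .nil t => 2 * t.toNat
  | .cons (.cons _ _) t => 2 * t.toNat + 1

theorem Val.toNat_ofNat (k : ℕ) : (Val.ofNat k).toNat = k := by
  unfold Val.ofNat
  induction k using Nat.binaryRec' with
  | zero => simp [Val.ofBits, Val.toNat]
  | bit b n h ih =>
    rw [Nat.bits_append_bit n b h]
    cases b <;> simp [Val.ofBits, Val.ofBool, Val.toNat, ih, Nat.bit]

/-- The datum `(a . b)` with `b ≠ 0` denotes the fraction `a / b` (not necessarily reduced). -/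
def Val.Denotes (v : Val) (y : ℝ) : Prop :=
  ∃ a b : Val, v = .cons a b ∧ b.toNat ≠ 0 ∧ y = (a.toNat : ℝ) / (b.toNat : ℝ)

/-- The description of a tree: a leaf with label `a / b` is `(nil . (a . b))`, a decision node is
`((nil . i) . (R₀ . R₁))`, a stochastic node is `(((nil . nil) . nil) . (R₀ . R₁))`;
all numbers are written in binary. -/
def RDT.encode {n : ℕ} : RDT n → Val
  | .leaf l _ _ => .cons .nil (.cons (.ofNat l.num.toNat) (.ofNat l.den))
  | .decision i R₀ R₁ => .cons (.cons .nil (.ofNat i)) (.cons R₀.encode R₁.encode)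
  | .stochastic R₀ R₁ => .cons (.cons (.cons .nil .nil) .nil) (.cons R₀.encode R₁.encode)

/-- The description length of a tree. A binary tree with `s` nodes is a string of `s` bits
(its nodes in preorder), so this is also the bit length of the description. -/
def RDT.descriptionLength {n : ℕ} (R : RDT n) : ℕ := R.encode.size

/-! ### The machine model

First-order functional programs over binary trees (pure first-order LISP), with query access to an
input. Every step builds at most one `cons` cell, inspects the root of one datum, or looks up one of
a bounded number of variables, so the number of steps is polynomially related to the running time
on a Turing machine or a RAM. -/

/-- Expressions. Variables are de Bruijn indices into the environment. -/
inductive Expr : Type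
  /-- the value of a variable -/
  | var (i : ℕ) : Expr
  /-- the atom -/
  | nil : Expr
  /-- pairing -/
  | cons (e₁ e₂ : Expr) : Expr
  /-- case distinction; in `e₂` the head and the tail are bound to the variables `0` and `1` -/
  | case (e e₁ e₂ : Expr) : Expr
  /-- local definition; in `e₂` the value of `e₁` is bound to the variable `0` -/
  | letIn (e₁ e₂ : Expr) : Expr
  /-- call of the `f`-th function of the program on one argument -/
  | call (f : ℕ) (e : Expr) : Expr
  /-- query of the input bit whose index is the value of `e` -/
  | query (e : Expr) : Expr
  /-- the binary digit of the error parameter whose index is the value of `e` -/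
  | digit (e : Expr) : Expr

/-- A program: a list of (mutually recursive) one-argument functions, and a main expression. -/
structure Program : Type where
  functions : List Expr
  main : Expr

/-- `Eval F x d env e v t m`: with function definitions `F`, input bits `x` and error parameter
digits `d`, the expression `e` evaluates in the environment `env` to `v` in exactly `t` steps,
making exactly `m` queries to the input (call by value; every expression node that is evaluated
counts as one step). -/
inductive Eval (F : List Expr) (x d : ℕ → Bool) : List Val → Expr → Val → ℕ → ℕ → Prop
  | var {env : List Val} {i : ℕ} {v : Val} (h : env[i]? = some v) :
      Eval F x d env (.var i) v 1 0
  | nil {env : List Val} : Eval F x d env .nil .nil 1 0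
  | cons {env : List Val} {e₁ e₂ : Expr} {v₁ v₂ : Val} {t₁ t₂ m₁ m₂ : ℕ}
      (h₁ : Eval F x d env e₁ v₁ t₁ m₁) (h₂ : Eval F x d env e₂ v₂ t₂ m₂) :
      Eval F x d env (.cons e₁ e₂) (.cons v₁ v₂) (t₁ + t₂ + 1) (m₁ + m₂)
  | case_nil {env : List Val} {e e₁ e₂ : Expr} {v : Val} {t t₁ m m₁ : ℕ}
      (h : Eval F x d env e .nil t m) (h₁ : Eval F x d env e₁ v t₁ m₁) :
      Eval F x d env (.case e e₁ e₂) v (t + t₁ + 1) (m + m₁)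
  | case_cons {env : List Val} {e e₁ e₂ : Expr} {a b v : Val} {t t₂ m m₂ : ℕ}
      (h : Eval F x d env e (.cons a b) t m) (h₂ : Eval F x d (a :: b :: env) e₂ v t₂ m₂) :
      Eval F x d env (.case e e₁ e₂) v (t + t₂ + 1) (m + m₂)
  | letIn {env : List Val} {e₁ e₂ : Expr} {v₁ v₂ : Val} {t₁ t₂ m₁ m₂ : ℕ}
      (h₁ : Eval F x d env e₁ v₁ t₁ m₁) (h₂ : Eval F x d (v₁ :: env) e₂ v₂ t₂ m₂) :
      Eval F x d env (.letIn e₁ e₂) v₂ (t₁ + t₂ + 1) (m₁ + m₂)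
  | call {env : List Val} {f : ℕ} {e body : Expr} {v w : Val} {t t' m m' : ℕ}
      (hf : F[f]? = some body)
      (h : Eval F x d env e v t m) (h' : Eval F x d [v] body w t' m') :
      Eval F x d env (.call f e) w (t + t' + 1) (m + m')
  | query {env : List Val} {e : Expr} {v : Val} {t m : ℕ} (h : Eval F x d env e v t m) :
      Eval F x d env (.query e) (.ofBool (x v.toNat)) (t + 1) (m + 1)
  | digit {env : List Val} {e : Expr} {v : Val} {t m : ℕ} (h : Eval F x d env e v t m) :
      Eval F x d env (.digit e) (.ofBool (d v.toNat)) (t + 1) m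

/-- Evaluation is deterministic: the result, the time and the number of queries are unique. -/
theorem Eval.unique {F : List Expr} {x d : ℕ → Bool} {env : List Val} {e : Expr} {v v' : Val}
    {t t' m m' : ℕ} (h : Eval F x d env e v t m) (h' : Eval F x d env e v' t' m') :
    v = v' ∧ t = t' ∧ m = m' := by
  induction h generalizing v' t' m' with
  | var h =>
    cases h' with
    | var h2 => rw [h] at h2; simp_all
  | nil => cases h'; simp
  | cons _ _ ih1 ih2 =>
    cases h' with
    | cons k1 k2 =>
      obtain ⟨rfl, rfl, rfl⟩ := ih1 k1
      obtain ⟨rfl, rfl, rfl⟩ := ih2 k2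
      simp
  | case_nil _ _ ih1 ih2 =>
    cases h' with
    | case_nil k1 k2 =>
      obtain ⟨-, rfl, rfl⟩ := ih1 k1
      obtain ⟨rfl, rfl, rfl⟩ := ih2 k2
      simp
    | case_cons k1 k2 => exact absurd (ih1 k1).1 (by simp)
  | case_cons _ _ ih1 ih2 =>
    cases h' with
    | case_nil k1 k2 => exact absurd (ih1 k1).1 (by simp)
    | case_cons k1 k2 =>
      obtain ⟨h0, rfl, rfl⟩ := ih1 k1
      obtain ⟨rfl, rfl⟩ := Val.cons.inj h0
      obtain ⟨rfl, rfl, rfl⟩ := ih2 k2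
      simp
  | letIn _ _ ih1 ih2 =>
    cases h' with
    | letIn k1 k2 =>
      obtain ⟨rfl, rfl, rfl⟩ := ih1 k1
      obtain ⟨rfl, rfl, rfl⟩ := ih2 k2
      simp
  | call hf _ _ ih1 ih2 =>
    cases h' with
    | call kf k1 k2 =>
      rw [hf] at kf
      obtain rfl := Option.some.inj kf
      obtain ⟨rfl, rfl, rfl⟩ := ih1 k1
      obtain ⟨rfl, rfl, rfl⟩ := ih2 k2
      simp
  | query _ ih =>
    cases h' with
    | query k =>
      obtain ⟨rfl, rfl, rfl⟩ := ih k
      simp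
  | digit _ ih =>
    cases h' with
    | digit k =>
      obtain ⟨rfl, rfl, rfl⟩ := ih k
      simp

/-- The `i`-th digit after the binary point of a real number `ε ∈ [0,1)`. -/
noncomputable def binaryDigit (ε : ℝ) (i : ℕ) : Bool :=
  decide (⌊ε * 2 ^ (i + 1)⌋₊ % 2 = 1)

/-- `P.RunsOn R ε x v t m`: the program `P`, given the description of the tree `R`, read access to
the binary digits of `ε` and query access to the string `x`, returns `v` after exactly `t` steps,
having made exactly `m` queries to `x`. -/
def Program.RunsOn (P : Program) {n : ℕ} (R : RDT n) (ε : ℝ) (x : Fin n → Bool)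
    (v : Val) (t m : ℕ) : Prop :=
  Eval P.functions (padBits x) (binaryDigit ε) [R.encode] P.main v t m

end QueryDerand

/-!
Resolving every stochastic node of `R` by an independent coin gives a random deterministic tree `T`
with `E[T(x)] = μ_R(x)` for every `x`. So the average of `t` such trees has mean square distance at
most `1 / t` from `μ_R`, and `t = O(1 / ε)` trees, with `q` queries each, suffice. This is more
economical than the `O(q² / ε³)` queries that are allowed.

The trees are found deterministically by the method of conditional expectations. Let
`S = ∑ (T_j - μ_R)` be the deviation of the trees chosen so far (`deviation`). If the next tree
satisfies `E[S T] ≤ E[S μ_R]`, then `E[(S + T - μ_R)²] ≤ E[S²] + 1`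
(`mean_deviation_cons_sq_le`), so that after `t` steps the average is within `1 / t` of `μ_R` in
mean square. As `E[S T]` is linear in `T`, such a tree arises from `R` by descending from the root
and taking at each stochastic node the branch with the smaller correlation with `S`, conditioned on the
answers on the path (`resolve_ev`). These correlations are means of products of two trees under a
restriction (`prodMean_ev`); they are computed exactly, as fractions with polynomially many digits,
in time quadratic in the size of the trees, up to the cost of the arithmetic.

The number of trees is the power of two `t` with `1 / ε ≤ t < 2 / ε` that the position of the first
digit `1` of `ε` gives (`exists_first_digit`). None of the choices depends on the input, which is
queried only to evaluate the chosen trees.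

The program is a table of functions `Code.functions`; each has a lemma with a name in `_ev` that
gives its result together with a bound for its time. Time bounds are kept as nested expressions in
one size parameter `K`, and are seen to be polynomial only at the end (`PolyBounded`).
-/

namespace QueryDerand

/-! ### The program -/

namespace Code

/-- The bit `1`. -/
def one : Expr := .cons .nil .nil

/-- `inc a`: the successor of a numeral. -/
def inc : Expr :=
  .case (.var 0) (.cons one .nil)
    (.case (.var 0) (.cons one (.var 1)) (.cons .nil (.call 0 (.var 3))))

/-- `add (a . b)`: the sum of two numerals. -/
def add : Expr :=
  .case (.var 0) .nil <| .case (.var 0) (.var 1) <| .case (.var 3) (.var 2) <|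
    .letIn (.call 1 (.cons (.var 3) (.var 1))) <|
      .case (.var 3) (.cons (.var 1) (.var 0)) <|
        .case (.var 3) (.cons (.var 5) (.var 2)) (.cons .nil (.call 0 (.var 4)))

/-- `mul (a . b)`: the product of two numerals. -/
def mul : Expr :=
  .case (.var 0) .nil <| .case (.var 0) .nil <|
    .letIn (.cons .nil (.call 2 (.cons (.var 1) (.var 3)))) <|
      .case (.var 1) (.var 0) (.call 1 (.cons (.var 6) (.var 2)))

/-- `le (c . (a . b))`: whether `a < b`, or `a = b` and `c` is the bit `1`. The numerals are
compared from the least significant bit on; `c` is the outcome for the bits read so far. -/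
def le : Expr :=
  .case (.var 0) .nil <| .case (.var 1) .nil <| .case (.var 0)
    (.case (.var 1) (.var 2) <| .case (.var 0)
      (.call 3 (.cons (.var 4) (.cons .nil (.var 1))))
      (.call 3 (.cons one (.cons .nil (.var 3)))))
    (.case (.var 3)
      (.case (.var 0)
        (.call 3 (.cons (.var 4) (.cons (.var 1) .nil)))
        (.call 3 (.cons .nil (.cons (.var 3) .nil))))
      (.case (.var 2)
        (.case (.var 0)
          (.call 3 (.cons (.var 6) (.cons (.var 3) (.var 1))))
          (.call 3 (.cons one (.cons (.var 5) (.var 3)))))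
        (.case (.var 2)
          (.call 3 (.cons .nil (.cons (.var 5) (.var 3))))
          (.call 3 (.cons (.var 10) (.cons (.var 7) (.var 5)))))))

/-- `eq (a . b)`: whether two numerals have the same value. -/
def eq : Expr :=
  .case (.var 0) .nil <|
    .case (.call 3 (.cons one (.cons (.var 0) (.var 1)))) .nil
      (.call 3 (.cons one (.cons (.var 3) (.var 2))))

/-- `lookup (i . ρ)`: the value of the variable `i` under the restriction `ρ`, wrapped in a
one-element list, and `nil` if `ρ` leaves `i` free. -/
def lookup : Expr :=
  .case (.var 0) .nil <| .case (.var 1) .nil <| .case (.var 0) .nil <|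
    .case (.call 4 (.cons (.var 0) (.var 4)))
      (.call 5 (.cons (.var 4) (.var 3))) (.cons (.var 3) .nil)

/-- `fadd (f . g)`: the sum of two fractions. -/
def fadd : Expr :=
  .case (.var 0) .nil <| .case (.var 0) .nil <| .case (.var 3) .nil <|
    .cons
      (.call 1 (.cons (.call 2 (.cons (.var 2) (.var 1))) (.call 2 (.cons (.var 0) (.var 3)))))
      (.call 2 (.cons (.var 3) (.var 1)))

/-- `favg (f . g)`: the average of two fractions. -/
def favg : Expr := .case (.call 6 (.var 0)) .nil (.cons (.var 0) (.cons .nil (.var 1)))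

/-- `fmul (f . g)`: the product of two fractions. -/
def fmul : Expr :=
  .case (.var 0) .nil <| .case (.var 0) .nil <| .case (.var 3) .nil <|
    .cons (.call 2 (.cons (.var 2) (.var 0))) (.call 2 (.cons (.var 3) (.var 1)))

/-- `fle (f . g)`: whether `f ≤ g`, for fractions `f` and `g`. -/
def fle : Expr :=
  .case (.var 0) .nil <| .case (.var 0) .nil <| .case (.var 3) .nil <|
    .call 3 (.cons one
      (.cons (.call 2 (.cons (.var 2) (.var 1))) (.call 2 (.cons (.var 0) (.var 3)))))

/-- `prodMean (l . ρ)`: the mean, over the inputs that agree with the restriction `ρ`, of the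
product of the mean functions of the trees in the list `l`. -/
def prodMean : Expr :=
  .case (.var 0) .nil <|
    .case (.var 0) (.cons (.cons one .nil) (.cons one .nil)) <| .case (.var 0) .nil <|
      .case (.var 0) (.call 8 (.cons (.var 1) (.call 10 (.cons (.var 3) (.var 5))))) <|
        .case (.var 3) .nil <| .case (.var 2)
          (.case (.call 5 (.cons (.var 3) (.var 9)))
            (.call 7 (.cons
              (.call 10 (.cons (.cons (.var 0) (.var 7)) (.cons (.cons (.var 3) .nil) (.var 9))))
              (.call 10 (.cons (.cons (.var 1) (.var 7)) (.cons (.cons (.var 3) one) (.var 9))))))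
            (.case (.var 0)
              (.call 10 (.cons (.cons (.var 2) (.var 9)) (.var 11)))
              (.call 10 (.cons (.cons (.var 5) (.var 11)) (.var 13)))))
          (.call 7 (.cons
            (.call 10 (.cons (.cons (.var 2) (.var 9)) (.var 11)))
            (.call 10 (.cons (.cons (.var 3) (.var 9)) (.var 11)))))

/-- `corr (L . (Ra . (Rb . (R . ρ))))`: the sum over the trees `T` in `L` of the means under `ρ` of
`T * Ra` and of `R * Rb`. -/
def corr : Expr :=
  .case (.var 0) .nil <| .case (.var 0) (.cons .nil (.cons one .nil)) <| .case (.var 3) .nil <|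
    .case (.var 1) .nil <| .case (.var 1) .nil <|
      .call 6 (.cons
        (.call 10 (.cons (.cons (.var 6) (.cons (.var 4) .nil)) (.var 1)))
        (.call 6 (.cons
          (.call 10 (.cons (.cons (.var 0) (.cons (.var 2) .nil)) (.var 1)))
          (.call 11 (.cons (.var 7) (.var 9))))))

/-- `resolve (R' . (ρ . (R . L)))`: a deterministic tree obtained from `R'` by choosing at each
stochastic node the branch that correlates least with the sum of the `T - R`, for `T` in `L`, on
the inputs that agree with `ρ` and lead to that node. -/
def resolve : Expr :=
  .case (.var 0) .nil <| .case (.var 1) .nil <| .case (.var 2) .nil <|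
    .case (.var 0) (.var 4) <| .case (.var 3) .nil <| .case (.var 2)
      (.case (.call 5 (.cons (.var 3) (.var 6)))
        (.cons (.var 4) (.cons
          (.call 12 (.cons (.var 0) (.cons (.cons (.cons (.var 3) .nil) (.var 6)) (.var 7))))
          (.call 12 (.cons (.var 1) (.cons (.cons (.cons (.var 3) one) (.var 6)) (.var 7))))))
        (.case (.var 0)
          (.call 12 (.cons (.var 2) (.cons (.var 8) (.var 9))))
          (.call 12 (.cons (.var 5) (.cons (.var 10) (.var 11))))))
      (.case (.var 9) .nil <|
        .case (.call 9 (.cons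
            (.call 11 (.cons (.var 1) (.cons (.var 4) (.cons (.var 5) (.cons (.var 0) (.var 10))))))
            (.call 11
              (.cons (.var 1) (.cons (.var 5) (.cons (.var 4) (.cons (.var 0) (.var 10))))))))
          (.call 12 (.cons (.var 5) (.cons (.var 10) (.var 11))))
          (.call 12 (.cons (.var 6) (.cons (.var 12) (.var 13)))))

/-- `greedy (w . (R . L))`: puts `w` further deterministic trees in front of the list `L`, where
the numeral `w` is a power of two. -/
def greedy : Expr :=
  .case (.var 0) .nil <| .case (.var 0) .nil <| .case (.var 3) .nil <| .case (.var 2)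
    (.call 13 (.cons (.var 3) (.cons (.var 0) (.call 13 (.cons (.var 3) (.var 5))))))
    (.cons (.call 12 (.cons (.var 2) (.cons .nil (.var 7)))) (.var 3))

/-- `evalTree T`: the label that the deterministic tree `T` reaches on the input. -/
def evalTree : Expr :=
  .case (.var 0) .nil <| .case (.var 0) (.var 1) <| .case (.var 3) .nil <|
    .case (.query (.var 3)) (.call 14 (.var 0)) (.call 14 (.var 3))

/-- `evalSum L`: the sum of the labels that the trees in `L` reach on the input. -/
def evalSum : Expr :=
  .case (.var 0) (.cons .nil (.cons one .nil))
    (.call 6 (.cons (.call 14 (.var 0)) (.call 15 (.var 1))))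

/-- `find (i . w)`: the numeral `w` doubled once for each digit `0` of the error parameter
between position `i` and the next digit `1`. -/
def find : Expr :=
  .case (.var 0) .nil <| .case (.digit (.var 0))
    (.call 16 (.cons (.call 0 (.var 0)) (.cons .nil (.var 1)))) (.var 3)

/-- The main expression: the average over `greedy` trees of their labels. -/
def main : Expr :=
  .letIn (.call 16 (.cons .nil (.cons .nil (.cons one .nil)))) <|
    .letIn (.call 15 (.call 13 (.cons (.var 0) (.cons (.var 1) .nil)))) <|
      .case (.var 0) .nil (.cons (.var 0) (.call 2 (.cons (.var 1) (.var 3))))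

/-- The function table that the numbers in `Expr.call` refer to. -/
def functions : List Expr :=
  [inc, add, mul, le, eq, lookup, fadd, favg, fmul, fle, prodMean, corr, resolve, greedy,
    evalTree, evalSum, find]

end Code

/-! ### Evaluation within given bounds -/

/-- `Ev x d env e v T m`: with the functions of `Code.functions`, the expression `e` evaluates to
`v` in at most `T` steps and with at most `m` queries. -/
def Ev (x d : ℕ → Bool) (env : List Val) (e : Expr) (v : Val) (T m : ℕ) : Prop :=
  ∃ t ≤ T, ∃ m' ≤ m, Eval Code.functions x d env e v t m'

namespace Ev

variable {x d : ℕ → Bool} {env : List Val} {e e₁ e₂ body : Expr} {v w v₁ v₂ a b : Val}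
  {t t' t₁ t₂ m m' m₁ m₂ f i : ℕ}

theorem mono (h : Ev x d env e v t m) (ht : t ≤ t') (hm : m ≤ m') : Ev x d env e v t' m' := by
  obtain ⟨s, hs, k, hk, h⟩ := h
  exact ⟨s, hs.trans ht, k, hk.trans hm, h⟩

theorem le (h : Ev x d env e v t 0) (ht : t ≤ t') : Ev x d env e v t' 0 := h.mono ht le_rfl

theorem var (h : env[i]? = some v) : Ev x d env (.var i) v 1 0 :=
  ⟨1, le_rfl, 0, le_rfl, .var h⟩

theorem nil : Ev x d env .nil .nil 1 0 := ⟨1, le_rfl, 0, le_rfl, .nil⟩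

theorem cons (h₁ : Ev x d env e₁ v₁ t₁ m₁) (h₂ : Ev x d env e₂ v₂ t₂ m₂) :
    Ev x d env (.cons e₁ e₂) (.cons v₁ v₂) (t₁ + t₂ + 1) (m₁ + m₂) := by
  obtain ⟨s₁, hs₁, k₁, hk₁, h₁⟩ := h₁
  obtain ⟨s₂, hs₂, k₂, hk₂, h₂⟩ := h₂
  exact ⟨_, by omega, _, by omega, .cons h₁ h₂⟩

theorem one : Ev x d env Code.one (Val.ofBool true) 3 0 := .cons .nil .nil

theorem case_nil (h : Ev x d env e .nil t m) (h₁ : Ev x d env e₁ v t₁ m₁) :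
    Ev x d env (.case e e₁ e₂) v (t + t₁ + 1) (m + m₁) := by
  obtain ⟨s, hs, k, hk, h⟩ := h
  obtain ⟨s₁, hs₁, k₁, hk₁, h₁⟩ := h₁
  exact ⟨_, by omega, _, by omega, .case_nil h h₁⟩

theorem case_cons (h : Ev x d env e (.cons a b) t m) (h₂ : Ev x d (a :: b :: env) e₂ v t₂ m₂) :
    Ev x d env (.case e e₁ e₂) v (t + t₂ + 1) (m + m₂) := by
  obtain ⟨s, hs, k, hk, h⟩ := h
  obtain ⟨s₂, hs₂, k₂, hk₂, h₂⟩ := h₂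
  exact ⟨_, by omega, _, by omega, .case_cons h h₂⟩

theorem letIn (h₁ : Ev x d env e₁ v₁ t₁ m₁) (h₂ : Ev x d (v₁ :: env) e₂ v₂ t₂ m₂) :
    Ev x d env (.letIn e₁ e₂) v₂ (t₁ + t₂ + 1) (m₁ + m₂) := by
  obtain ⟨s₁, hs₁, k₁, hk₁, h₁⟩ := h₁
  obtain ⟨s₂, hs₂, k₂, hk₂, h₂⟩ := h₂
  exact ⟨_, by omega, _, by omega, .letIn h₁ h₂⟩

theorem call (hf : Code.functions[f]? = some body) (h : Ev x d env e v t m)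
    (h' : Ev x d [v] body w t' m') : Ev x d env (.call f e) w (t + t' + 1) (m + m') := by
  obtain ⟨s, hs, k, hk, h⟩ := h
  obtain ⟨s', hs', k', hk', h'⟩ := h'
  exact ⟨_, by omega, _, by omega, .call hf h h'⟩

theorem query (h : Ev x d env e v t m) :
    Ev x d env (.query e) (.ofBool (x v.toNat)) (t + 1) (m + 1) := by
  obtain ⟨s, hs, k, hk, h⟩ := h
  exact ⟨_, by omega, _, by omega, .query h⟩

theorem digit (h : Ev x d env e v t m) :
    Ev x d env (.digit e) (.ofBool (d v.toNat)) (t + 1) m := by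
  obtain ⟨s, hs, k, hk, h⟩ := h
  exact ⟨_, by omega, _, by omega, .digit h⟩

end Ev

/-- An evaluation without queries does not depend on the input. -/
theorem Eval.change_input {F : List Expr} {x x' d : ℕ → Bool} {env : List Val} {e : Expr} {v : Val}
    {t m : ℕ} (h : Eval F x d env e v t m) (hm : m = 0) : Eval F x' d env e v t m := by
  induction h with
  | var h => exact .var h
  | nil => exact .nil
  | cons _ _ ih₁ ih₂ => exact .cons (ih₁ (by omega)) (ih₂ (by omega))
  | case_nil _ _ ih₁ ih₂ => exact .case_nil (ih₁ (by omega)) (ih₂ (by omega))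
  | case_cons _ _ ih₁ ih₂ => exact .case_cons (ih₁ (by omega)) (ih₂ (by omega))
  | letIn _ _ ih₁ ih₂ => exact .letIn (ih₁ (by omega)) (ih₂ (by omega))
  | call hf _ _ ih₁ ih₂ => exact .call hf (ih₁ (by omega)) (ih₂ (by omega))
  | query => omega
  | digit _ ih => exact .digit (ih hm)

theorem Ev.change_input {x d : ℕ → Bool} {env : List Val} {e : Expr} {v : Val} {T : ℕ}
    (h : Ev x d env e v T 0) (x' : ℕ → Bool) : Ev x' d env e v T 0 := by
  obtain ⟨t, ht, m, hm, h⟩ := h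
  exact ⟨t, ht, m, hm, h.change_input (by omega)⟩

/-! ### Arithmetic of numerals -/

/-- The number of digits of a numeral, leading zeros included. -/
def Val.len : Val → ℕ
  | .nil => 0
  | .cons _ b => b.len + 1

theorem Val.len_le_size (v : Val) : v.len ≤ v.size := by
  induction v with
  | nil => simp [Val.len]
  | cons a b _ ih => simp only [Val.len, Val.size]; omega

theorem Val.toNat_lt (v : Val) : v.toNat < 2 ^ v.len := by
  induction v with
  | nil => simp [Val.toNat, Val.len]
  | cons a b _ ih =>
    cases a <;> simp only [Val.toNat, Val.len, pow_succ] <;> omega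

section Arithmetic

variable {x d : ℕ → Bool}

/-- The last clause bounds the number of digits by any `K` that holds both the digits of `a` and the
value of the result. Leading zeros are allowed, so the digits are not determined by the value. -/
theorem inc_ev (a : Val) : ∃ v, Ev x d [a] Code.inc v (20 * a.len + 20) 0 ∧
    v.toNat = a.toNat + 1 ∧ ∀ K, a.len ≤ K → a.toNat + 1 < 2 ^ K → v.len ≤ K := by
  induction a with
  | nil =>
    refine ⟨_, (Ev.case_nil (.var rfl) (.cons .one .nil)).le (by omega), rfl, ?_⟩
    intro K _ h
    cases K with
    | zero => simp at h
    | succ K => simp [Val.len]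
  | cons h t _ ih =>
    cases h with
    | nil =>
      refine ⟨_, (Ev.case_cons (.var rfl) (.case_nil (.var rfl)
        (.cons .one (.var rfl)))).le (by omega), rfl, ?_⟩
      intro K h _
      simpa [Val.len] using h
    | cons p q =>
      obtain ⟨v, hv, hn, hl⟩ := ih
      refine ⟨_, (Ev.case_cons (.var rfl) (.case_cons (.var rfl)
        (.cons .nil (.call rfl (.var rfl) hv)))).le ?_, ?_, ?_⟩
      · simp only [Val.len]; omega
      · simp only [Val.toNat, hn]; omega
      · intro K h h'
        cases K with
        | zero => simp [Val.len] at h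
        | succ K =>
          simp only [Val.len, Val.toNat, pow_succ] at *
          have := hl K (by omega) (by omega)
          omega

/-- The bound on the digits of the sum is stated as for `inc_ev`: a bound that counted one more
digit for each carry would not survive in `mul_ev`, and repeated products would grow too long. -/
theorem add_ev_aux (K : ℕ) (a : Val) : ∀ b : Val, a.len ≤ K → b.len ≤ K →
    ∃ v, Ev x d [.cons a b] Code.add v (a.len * (20 * K + 60) + 20) 0 ∧
      v.toNat = a.toNat + b.toNat ∧
      ∀ K, a.len ≤ K → b.len ≤ K → a.toNat + b.toNat < 2 ^ K → v.len ≤ K := by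
  induction a with
  | nil =>
    intro b _ _
    exact ⟨b, (Ev.case_cons (.var rfl) (.case_nil (.var rfl) (.var rfl))).le (by omega),
      by simp [Val.toNat], fun K _ h _ => h⟩
  | cons h t _ ih =>
    intro b ha hb
    cases b with
    | nil =>
      exact ⟨.cons h t, (Ev.case_cons (.var rfl) (.case_cons (.var rfl)
        (.case_nil (.var rfl) (.var rfl)))).le (by omega), by simp [Val.toNat], fun K h _ _ => h⟩
    | cons h' t' =>
      simp only [Val.len] at ha hb
      obtain ⟨s, hs, hn, hl⟩ := ih t' (by omega) (by omega)
      have hT : (Val.cons h t).len * (20 * K + 60) + 20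
          = (t.len * (20 * K + 60) + 20) + (20 * K + 60) := by
        simp only [Val.len]; ring
      rw [hT]
      -- the recursive call on the tails, in the environment in which the program makes it
      have hs' := Ev.call (f := 1) (env := [h', t', h, t, .cons h t, .cons h' t',
        .cons (.cons h t) (.cons h' t')]) rfl
        (.cons (e₁ := .var 3) (e₂ := .var 1) (.var rfl) (.var rfl)) hs
      cases h with
      | nil =>
        refine ⟨_, (Ev.case_cons (.var rfl) (.case_cons (.var rfl) (.case_cons (.var rfl)
          (.letIn hs' (.case_nil (.var rfl) (.cons (.var rfl) (.var rfl))))))).le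
            (by omega), ?_, ?_⟩
        · cases h' <;> simp only [Val.toNat, hn] <;> omega
        · intro K hK _ hlt
          cases K with
          | zero => simp [Val.len] at hK
          | succ K =>
            simp only [Val.len] at *
            have := hl K (by omega) (by omega) (by
              cases h' <;> simp only [Val.toNat, pow_succ] at hlt <;> omega)
            omega
      | cons p q =>
        cases h' with
        | nil =>
          refine ⟨_, (Ev.case_cons (.var rfl) (.case_cons (.var rfl) (.case_cons (.var rfl)
            (.letIn hs' (.case_cons (.var rfl) (.case_nil (.var rfl)
              (.cons (.var rfl) (.var rfl)))))))).le (by omega), ?_, ?_⟩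
          · simp only [Val.toNat, hn]; omega
          · intro K h h' hlt
            cases K with
            | zero => simp [Val.len] at h
            | succ K =>
              simp only [Val.len, Val.toNat, pow_succ] at *
              have := hl K (by omega) (by omega) (by omega)
              omega
        | cons p' q' =>
          obtain ⟨v, hv, hvn, hvl⟩ := inc_ev (x := x) (d := d) s
          -- the tails have at most `K - 1` digits, so there is room for the carry
          have hsK : s.len ≤ K := by
            refine hl K (by omega) (by omega) ?_
            have h1 := t.toNat_lt
            have h2 := t'.toNat_lt
            have h3 : 2 ^ t.len ≤ 2 ^ (K - 1) := Nat.pow_le_pow_right (by omega) (by omega)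
            have h4 : 2 ^ t'.len ≤ 2 ^ (K - 1) := Nat.pow_le_pow_right (by omega) (by omega)
            obtain ⟨k, rfl⟩ : ∃ k, K = k + 1 := ⟨K - 1, by omega⟩
            simp only [Nat.add_sub_cancel, pow_succ] at *
            omega
          refine ⟨_, (Ev.case_cons (.var rfl) (.case_cons (.var rfl) (.case_cons (.var rfl)
            (.letIn hs' (.case_cons (.var rfl) (.case_cons (.var rfl)
              (.cons .nil (.call rfl (.var rfl) hv)))))))).le (by omega), ?_, ?_⟩
          · simp only [Val.toNat, hn, hvn]; omega
          · intro K h h' hlt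
            cases K with
            | zero => simp [Val.len] at h
            | succ K =>
              simp only [Val.len, Val.toNat, pow_succ] at *
              have h1 := hl K (by omega) (by omega) (by omega)
              have := hvl K h1 (by omega)
              omega

/-- A bound for the time of an addition of numerals with at most `K` digits. -/
def addTime (K : ℕ) : ℕ := K * (20 * K + 60) + 20

theorem add_ev {K : ℕ} {a b : Val} (ha : a.len ≤ K) (hb : b.len ≤ K) :
    ∃ v, Ev x d [.cons a b] Code.add v (addTime K) 0 ∧ v.toNat = a.toNat + b.toNat ∧
      ∀ K, a.len ≤ K → b.len ≤ K → a.toNat + b.toNat < 2 ^ K → v.len ≤ K := by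
  obtain ⟨v, hv, h⟩ := add_ev_aux (x := x) (d := d) K a b ha hb
  exact ⟨v, hv.le (by unfold addTime; gcongr), h⟩

theorem mul_ev_aux (K : ℕ) (a b : Val) (hK : a.len + b.len ≤ K) :
    ∃ v, Ev x d [.cons a b] Code.mul v (a.len * (addTime K + 40) + 20) 0 ∧
      v.toNat = a.toNat * b.toNat ∧ v.len ≤ a.len + b.len := by
  induction a with
  | nil =>
    exact ⟨.nil, (Ev.case_cons (.var rfl) (.case_nil (.var rfl) .nil)).le (by omega),
      by simp [Val.toNat], by simp [Val.len]⟩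
  | cons h t _ ih =>
    simp only [Val.len] at hK
    obtain ⟨s, hs, hn, hl⟩ := ih (by omega)
    have hT : (Val.cons h t).len * (addTime K + 40) + 20
        = (t.len * (addTime K + 40) + 20) + (addTime K + 40) := by
      simp only [Val.len]; ring
    rw [hT]
    have hs' := Ev.cons .nil (Ev.call (f := 2) (env := [h, t, .cons h t, b,
        .cons (.cons h t) b]) rfl (.cons (e₁ := .var 1) (e₂ := .var 3) (.var rfl) (.var rfl)) hs)
    cases h with
    | nil =>
      refine ⟨_, (Ev.case_cons (.var rfl) (.case_cons (.var rfl) (.letIn hs'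
        (.case_nil (.var rfl) (.var rfl))))).le (by omega), ?_, ?_⟩
      · simp only [Val.toNat, hn]; ring
      · simp only [Val.len]; omega
    | cons p q =>
      obtain ⟨v, hv, hvn, hvl⟩ := add_ev (x := x) (d := d) (K := K) (a := b) (b := .cons .nil s)
        (by omega) (by simp only [Val.len]; omega)
      refine ⟨_, (Ev.case_cons (.var rfl) (.case_cons (.var rfl) (.letIn hs'
        (.case_cons (.var rfl) (.call rfl (.cons (.var rfl) (.var rfl)) hv))))).le
          (by omega), ?_, ?_⟩
      · rw [hvn]; simp only [Val.toNat, hn]; ring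
      · have h1 := (Val.cons (.cons p q) t).toNat_lt
        have h2 := b.toNat_lt
        refine hvl _ (by omega) (by simp only [Val.len]; omega) ?_
        calc _ = (Val.cons (.cons p q) t).toNat * b.toNat := by simp only [Val.toNat, hn]; ring
          _ < _ := by rw [pow_add]; exact Nat.mul_lt_mul'' h1 h2

/-- A bound for the time of a multiplication of numerals with at most `K` digits. -/
def mulTime (K : ℕ) : ℕ := K * (addTime (2 * K) + 40) + 20

theorem mul_ev {K : ℕ} {a b : Val} (ha : a.len ≤ K) (hb : b.len ≤ K) :
    ∃ v, Ev x d [.cons a b] Code.mul v (mulTime K) 0 ∧ v.toNat = a.toNat * b.toNat ∧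
      v.len ≤ a.len + b.len := by
  obtain ⟨v, hv, h⟩ := mul_ev_aux (x := x) (d := d) (2 * K) a b (by omega)
  exact ⟨v, hv.le (by unfold mulTime; gcongr), h⟩

/-- What `Code.le` decides. -/
def LeSpec (c a b v : Val) : Prop :=
  v ≠ .nil ↔ a.toNat < b.toNat ∨ (a.toNat = b.toNat ∧ c ≠ .nil)

/-- The part of `le_ev` in which the first numeral is used up. -/
theorem le_ev_nil (b : Val) : ∀ c : Val,
    ∃ v, Ev x d [.cons c (.cons .nil b)] Code.le v (40 * b.len + 20) 0 ∧ LeSpec c .nil b v := by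
  induction b with
  | nil =>
    intro c
    exact ⟨c, (Ev.case_cons (.var rfl) (.case_cons (.var rfl) (.case_nil (.var rfl)
      (.case_nil (.var rfl) (.var rfl))))).le (by omega), by simp [LeSpec]⟩
  | cons h t _ ih =>
    intro c
    cases h with
    | nil =>
      obtain ⟨v, hv, hs⟩ := ih c
      refine ⟨v, (Ev.case_cons (.var rfl) (.case_cons (.var rfl) (.case_nil (.var rfl)
        (.case_cons (.var rfl) (.case_nil (.var rfl)
          (.call rfl (.cons (.var rfl) (.cons .nil (.var rfl))) hv)))))).le ?_, ?_⟩
      · simp only [Val.len]; omega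
      · unfold LeSpec at *; rw [hs]; simp only [Val.toNat]; grind
    | cons p q =>
      obtain ⟨v, hv, hs⟩ := ih (Val.ofBool true)
      refine ⟨v, (Ev.case_cons (.var rfl) (.case_cons (.var rfl) (.case_nil (.var rfl)
        (.case_cons (.var rfl) (.case_cons (.var rfl)
          (.call rfl (.cons .one (.cons .nil (.var rfl))) hv)))))).le ?_, ?_⟩
      · simp only [Val.len]; omega
      · unfold LeSpec at *; rw [hs]; simp only [Val.toNat, Val.ofBool]; grind

theorem le_ev (a : Val) : ∀ b c : Val,
    ∃ v, Ev x d [.cons c (.cons a b)] Code.le v (40 * (a.len + b.len) + 20) 0 ∧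
      LeSpec c a b v := by
  induction a with
  | nil =>
    intro b c
    obtain ⟨v, hv, hs⟩ := le_ev_nil (x := x) (d := d) b c
    exact ⟨v, hv.le (by omega), hs⟩
  | cons h t _ ih =>
    intro b c
    cases b with
    | nil =>
      cases h with
      | nil =>
        obtain ⟨v, hv, hs⟩ := ih .nil c
        refine ⟨v, (Ev.case_cons (.var rfl) (.case_cons (.var rfl) (.case_cons (.var rfl)
          (.case_nil (.var rfl) (.case_nil (.var rfl)
            (.call rfl (.cons (.var rfl) (.cons (.var rfl) .nil)) hv)))))).le ?_, ?_⟩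
        · simp only [Val.len]; omega
        · unfold LeSpec at *; rw [hs]; simp only [Val.toNat]; grind
      | cons p q =>
        obtain ⟨v, hv, hs⟩ := ih .nil .nil
        refine ⟨v, (Ev.case_cons (.var rfl) (.case_cons (.var rfl) (.case_cons (.var rfl)
          (.case_nil (.var rfl) (.case_cons (.var rfl)
            (.call rfl (.cons .nil (.cons (.var rfl) .nil)) hv)))))).le ?_, ?_⟩
        · simp only [Val.len]; omega
        · unfold LeSpec at *; rw [hs]; simp only [Val.toNat]; grind
    | cons h' t' =>
      cases h with
      | nil =>
        cases h' with
        | nil =>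
          obtain ⟨v, hv, hs⟩ := ih t' c
          refine ⟨v, (Ev.case_cons (.var rfl) (.case_cons (.var rfl) (.case_cons (.var rfl)
            (.case_cons (.var rfl) (.case_nil (.var rfl) (.case_nil (.var rfl)
              (.call rfl (.cons (.var rfl) (.cons (.var rfl) (.var rfl))) hv))))))).le ?_, ?_⟩
          · simp only [Val.len]; omega
          · unfold LeSpec at *; rw [hs]; simp only [Val.toNat]; grind
        | cons p q =>
          obtain ⟨v, hv, hs⟩ := ih t' (Val.ofBool true)
          refine ⟨v, (Ev.case_cons (.var rfl) (.case_cons (.var rfl) (.case_cons (.var rfl)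
            (.case_cons (.var rfl) (.case_nil (.var rfl) (.case_cons (.var rfl)
              (.call rfl (.cons .one (.cons (.var rfl) (.var rfl))) hv))))))).le ?_, ?_⟩
          · simp only [Val.len]; omega
          · unfold LeSpec at *; rw [hs]; simp only [Val.toNat, Val.ofBool]; grind
      | cons p q =>
        cases h' with
        | nil =>
          obtain ⟨v, hv, hs⟩ := ih t' .nil
          refine ⟨v, (Ev.case_cons (.var rfl) (.case_cons (.var rfl) (.case_cons (.var rfl)
            (.case_cons (.var rfl) (.case_cons (.var rfl) (.case_nil (.var rfl)
              (.call rfl (.cons .nil (.cons (.var rfl) (.var rfl))) hv))))))).le ?_, ?_⟩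
          · simp only [Val.len]; omega
          · unfold LeSpec at *; rw [hs]; simp only [Val.toNat]; grind
        | cons p' q' =>
          obtain ⟨v, hv, hs⟩ := ih t' c
          refine ⟨v, (Ev.case_cons (.var rfl) (.case_cons (.var rfl) (.case_cons (.var rfl)
            (.case_cons (.var rfl) (.case_cons (.var rfl) (.case_cons (.var rfl)
              (.call rfl (.cons (.var rfl) (.cons (.var rfl) (.var rfl))) hv))))))).le ?_, ?_⟩
          · simp only [Val.len]; omega
          · unfold LeSpec at *; rw [hs]; simp only [Val.toNat]; grind

theorem eq_ev {K : ℕ} {a b : Val} (ha : a.len ≤ K) (hb : b.len ≤ K) :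
    ∃ v, Ev x d [.cons a b] Code.eq v (160 * K + 80) 0 ∧ (v ≠ .nil ↔ a.toNat = b.toNat) := by
  obtain ⟨v, hv, hs⟩ := le_ev (x := x) (d := d) a b (Val.ofBool true)
  obtain ⟨w, hw, hs'⟩ := le_ev (x := x) (d := d) b a (Val.ofBool true)
  have hc := Ev.call (f := 3) (env := [a, b, .cons a b]) rfl
    (.cons (e₁ := Code.one) .one (.cons (e₁ := .var 0) (e₂ := .var 1) (.var rfl) (.var rfl))) hv
  cases v with
  | nil =>
    refine ⟨_, (Ev.case_cons (.var rfl) (.case_nil hc .nil)).le (by omega), ?_⟩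
    simp [LeSpec, Val.ofBool] at hs
    simp; omega
  | cons p q =>
    refine ⟨w, (Ev.case_cons (.var rfl) (.case_cons hc
      (.call rfl (.cons .one (.cons (.var rfl) (.var rfl))) hw))).le (by omega), ?_⟩
    simp [LeSpec, Val.ofBool] at hs hs'
    simp [hs']; omega

/-! ### Arithmetic of fractions -/

/-- The datum `v` is a fraction with value `y`, whose numerator and denominator have at most `B`
digits. -/
def IsFrac (v : Val) (y : ℝ) (B : ℕ) : Prop :=
  ∃ a b : Val, v = .cons a b ∧ b.toNat ≠ 0 ∧ y = (a.toNat : ℝ) / (b.toNat : ℝ) ∧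
    a.len ≤ B ∧ b.len ≤ B

theorem IsFrac.mono {v : Val} {y : ℝ} {B B' : ℕ} (h : IsFrac v y B) (hB : B ≤ B') :
    IsFrac v y B' := by
  obtain ⟨a, b, h1, h2, h3, h4, h5⟩ := h
  exact ⟨a, b, h1, h2, h3, h4.trans hB, h5.trans hB⟩

/-- A bound for the time of an operation on fractions with at most `K` digits. -/
def fracTime (K : ℕ) : ℕ := 3 * mulTime K + addTime (2 * K) + 160 * K + 100

theorem fadd_ev {K B B' : ℕ} {f g : Val} {y z : ℝ} (hf : IsFrac f y B) (hg : IsFrac g z B')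
    (hB : B ≤ K) (hB' : B' ≤ K) :
    ∃ v, Ev x d [.cons f g] Code.fadd v (fracTime K) 0 ∧ IsFrac v (y + z) (B + B' + 1) := by
  obtain ⟨p, q, rfl, hq, rfl, hpl, hql⟩ := hf
  obtain ⟨r, s, rfl, hs, rfl, hrl, hsl⟩ := hg
  obtain ⟨ps, h1, n1, l1⟩ := mul_ev (x := x) (d := d) (K := K) (a := p) (b := s)
    (by omega) (by omega)
  obtain ⟨rq, h2, n2, l2⟩ := mul_ev (x := x) (d := d) (K := K) (a := r) (b := q)
    (by omega) (by omega)
  obtain ⟨qs, h3, n3, l3⟩ := mul_ev (x := x) (d := d) (K := K) (a := q) (b := s)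
    (by omega) (by omega)
  obtain ⟨u, h4, n4, l4⟩ := add_ev (x := x) (d := d) (K := 2 * K) (a := ps) (b := rq)
    (by omega) (by omega)
  refine ⟨_, (Ev.case_cons (.var rfl) (.case_cons (.var rfl) (.case_cons (.var rfl)
    (.cons (.call rfl (.cons (.call rfl (.cons (.var rfl) (.var rfl)) h1)
      (.call rfl (.cons (.var rfl) (.var rfl)) h2)) h4)
      (.call rfl (.cons (.var rfl) (.var rfl)) h3))))).le (by unfold fracTime; omega),
    u, qs, rfl, ?_, ?_, ?_, by omega⟩
  · rw [n3]; exact mul_ne_zero hq hs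
  · rw [n4, n3, n1, n2]
    have : (q.toNat : ℝ) ≠ 0 := by exact_mod_cast hq
    have : (s.toNat : ℝ) ≠ 0 := by exact_mod_cast hs
    push_cast
    field_simp
  · refine l4 _ (by omega) (by omega) ?_
    have e1 : ps.toNat < 2 ^ (B + B') :=
      ps.toNat_lt.trans_le (Nat.pow_le_pow_right (by omega) (by omega))
    have e2 : rq.toNat < 2 ^ (B + B') :=
      rq.toNat_lt.trans_le (Nat.pow_le_pow_right (by omega) (by omega))
    rw [pow_succ]; omega

theorem favg_ev {K B B' : ℕ} {f g : Val} {y z : ℝ} (hf : IsFrac f y B) (hg : IsFrac g z B')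
    (hB : B ≤ K) (hB' : B' ≤ K) :
    ∃ v, Ev x d [.cons f g] Code.favg v (fracTime K + 10) 0 ∧
      IsFrac v ((y + z) / 2) (B + B' + 2) := by
  obtain ⟨_, hv, a, b, rfl, hb, hy, ha', hb'⟩ := fadd_ev (x := x) (d := d) hf hg hB hB'
  refine ⟨_, (Ev.case_cons (.call rfl (.var rfl) hv)
    (.cons (.var rfl) (.cons .nil (.var rfl)))).le (by omega), _, _, rfl, ?_, ?_, ?_, ?_⟩
  · simpa [Val.toNat] using hb
  · rw [hy]; simp only [Val.toNat]; push_cast; rw [div_div, mul_comm]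
  · omega
  · simp only [Val.len]; omega

theorem fmul_ev {K B B' : ℕ} {f g : Val} {y z : ℝ} (hf : IsFrac f y B) (hg : IsFrac g z B')
    (hB : B ≤ K) (hB' : B' ≤ K) :
    ∃ v, Ev x d [.cons f g] Code.fmul v (fracTime K) 0 ∧ IsFrac v (y * z) (B + B') := by
  obtain ⟨p, q, rfl, hq, rfl, hpl, hql⟩ := hf
  obtain ⟨r, s, rfl, hs, rfl, hrl, hsl⟩ := hg
  obtain ⟨pr, h1, n1, l1⟩ := mul_ev (x := x) (d := d) (K := K) (a := p) (b := r)
    (by omega) (by omega)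
  obtain ⟨qs, h3, n3, l3⟩ := mul_ev (x := x) (d := d) (K := K) (a := q) (b := s)
    (by omega) (by omega)
  refine ⟨_, (Ev.case_cons (.var rfl) (.case_cons (.var rfl) (.case_cons (.var rfl)
    (.cons (.call rfl (.cons (.var rfl) (.var rfl)) h1)
      (.call rfl (.cons (.var rfl) (.var rfl)) h3))))).le (by unfold fracTime; omega),
    pr, qs, rfl, ?_, ?_, by omega, by omega⟩
  · rw [n3]; exact mul_ne_zero hq hs
  · rw [n3, n1]; push_cast; rw [div_mul_div_comm]

theorem fle_ev {K B B' : ℕ} {f g : Val} {y z : ℝ} (hf : IsFrac f y B) (hg : IsFrac g z B')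
    (hB : B ≤ K) (hB' : B' ≤ K) :
    ∃ v, Ev x d [.cons f g] Code.fle v (fracTime K) 0 ∧ (v ≠ .nil ↔ y ≤ z) := by
  obtain ⟨p, q, rfl, hq, rfl, hpl, hql⟩ := hf
  obtain ⟨r, s, rfl, hs, rfl, hrl, hsl⟩ := hg
  obtain ⟨ps, h1, n1, l1⟩ := mul_ev (x := x) (d := d) (K := K) (a := p) (b := s)
    (by omega) (by omega)
  obtain ⟨rq, h2, n2, l2⟩ := mul_ev (x := x) (d := d) (K := K) (a := r) (b := q)
    (by omega) (by omega)
  obtain ⟨v, h3, hv⟩ := le_ev (x := x) (d := d) ps rq (Val.ofBool true)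
  refine ⟨v, (Ev.case_cons (.var rfl) (.case_cons (.var rfl) (.case_cons (.var rfl)
    (.call rfl (.cons .one (.cons (.call rfl (.cons (.var rfl) (.var rfl)) h1)
      (.call rfl (.cons (.var rfl) (.var rfl)) h2))) h3)))).le (by unfold fracTime; omega), ?_⟩
  have hq' : (0 : ℝ) < q.toNat := by exact_mod_cast Nat.pos_of_ne_zero hq
  have hs' : (0 : ℝ) < s.toNat := by exact_mod_cast Nat.pos_of_ne_zero hs
  rw [div_le_div_iff₀ hq' hs']
  simp only [LeSpec, n1, n2, Val.ofBool] at hv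
  rw [hv]
  norm_cast
  simp
  omega

theorem isFrac_one : IsFrac (.cons (.cons (.ofBool true) .nil) (.cons (.ofBool true) .nil)) 1 1 :=
  ⟨_, _, rfl, by simp [Val.toNat, Val.ofBool], by simp [Val.toNat, Val.ofBool],
    by simp [Val.len], by simp [Val.len]⟩

theorem isFrac_zero : IsFrac (.cons .nil (.cons (.ofBool true) .nil)) 0 1 :=
  ⟨_, _, rfl, by simp [Val.toNat, Val.ofBool], by simp [Val.toNat],
    by simp [Val.len], by simp [Val.len]⟩

end Arithmetic

/-! ### Mean functions of trees -/

/-- The mean function of a tree, by recursion on the tree. -/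
noncomputable def RDT.mu {n : ℕ} (x : Fin n → Bool) : RDT n → ℝ
  | .leaf l _ _ => (l : ℝ)
  | .decision i R₀ R₁ => if x i then R₁.mu x else R₀.mu x
  | .stochastic R₀ R₁ => (R₀.mu x + R₁.mu x) / 2

theorem RDT.mu_nonneg {n : ℕ} (x : Fin n → Bool) (R : RDT n) : 0 ≤ R.mu x := by
  induction R with
  | leaf l h _ => simpa [RDT.mu] using h
  | decision i R₀ R₁ h₀ h₁ => simp only [RDT.mu]; split_ifs <;> assumption
  | stochastic R₀ R₁ h₀ h₁ => simp only [RDT.mu]; linarith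

theorem RDT.mu_le_one {n : ℕ} (x : Fin n → Bool) (R : RDT n) : R.mu x ≤ 1 := by
  induction R with
  | leaf l _ h => simp only [RDT.mu]; exact_mod_cast h
  | decision i R₀ R₁ h₀ h₁ => simp only [RDT.mu]; split_ifs <;> assumption
  | stochastic R₀ R₁ h₀ h₁ => simp only [RDT.mu]; linarith

theorem padBits_cons_zero {M : ℕ} (b : Bool) (r : Fin M → Bool) :
    padBits (Fin.cons b r : Fin (M + 1) → Bool) 0 = b := by
  simp [padBits]

theorem padBits_cons_succ {M : ℕ} (b : Bool) (r : Fin M → Bool) :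
    (fun j => padBits (Fin.cons b r : Fin (M + 1) → Bool) (j + 1)) = padBits r := by
  funext j
  by_cases h : j < M
  · rw [padBits, padBits, dif_pos h, dif_pos (Nat.succ_lt_succ h)]
    exact Fin.cons_succ (α := fun _ => Bool) b r ⟨j, h⟩
  · rw [padBits, padBits, dif_neg h, dif_neg (fun h' => h (Nat.lt_of_succ_lt_succ h'))]

theorem expect_bool (f : Bool → ℝ) : 𝔼 b, f b = (f false + f true) / 2 := by
  rw [Fintype.expect_eq_sum_div_card]
  simp [add_comm]

theorem expect_cons {M : ℕ} (f : (Fin (M + 1) → Bool) → ℝ) :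
    𝔼 r, f r = ((𝔼 r : Fin M → Bool, f (Fin.cons false r : Fin (M + 1) → Bool)) +
      𝔼 r : Fin M → Bool, f (Fin.cons true r : Fin (M + 1) → Bool)) / 2 := by
  rw [← expect_bool (fun b => 𝔼 r : Fin M → Bool, f (Fin.cons b r : Fin (M + 1) → Bool)),
    ← Finset.expect_product' (s := Finset.univ) (t := Finset.univ)
      (f := fun b (r : Fin M → Bool) => f (Fin.cons b r : Fin (M + 1) → Bool)),
    Finset.univ_product_univ]
  symm
  exact Fintype.expect_equiv (Fin.consEquiv fun _ => Bool) _ _ (fun p => rfl)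

/-- The mean of `R.run` over any sufficient number of coins: unused coins do not matter. -/
theorem RDT.expect_run {n : ℕ} (x : Fin n → Bool) (R : RDT n) :
    ∀ M, R.randomnessComplexity ≤ M → 𝔼 r : Fin M → Bool, R.run x (padBits r) = R.mu x := by
  induction R with
  | leaf l _ _ => intro M _; simp [RDT.run, RDT.mu]
  | decision i R₀ R₁ h₀ h₁ =>
    intro M hM
    simp only [RDT.randomnessComplexity, max_le_iff] at hM
    by_cases h : x i
    · simpa [RDT.run, RDT.mu, h] using h₁ M hM.2
    · simpa [RDT.run, RDT.mu, h] using h₀ M hM.1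
  | stochastic R₀ R₁ h₀ h₁ =>
    intro M hM
    simp only [RDT.randomnessComplexity] at hM
    obtain ⟨M, rfl⟩ : ∃ k, M = k + 1 := ⟨M - 1, by omega⟩
    rw [expect_cons]
    simp only [RDT.run, padBits_cons_zero, padBits_cons_succ, RDT.mu]
    simp [h₀ M (by omega), h₁ M (by omega)]

theorem RDT.mean_eq_mu {n : ℕ} (x : Fin n → Bool) (R : RDT n) : R.mean x = R.mu x :=
  R.expect_run x _ le_rfl

/-! ### Restrictions -/

section Restrictions

variable {n : ℕ}

/-- A restriction fixes some of the input bits; where entries collide, the first one counts. -/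
abbrev Restriction (n : ℕ) : Type := List (Fin n × Bool)

/-- The bit to which a restriction fixes a variable, if any. -/
def Restriction.get (i : Fin n) : Restriction n → Option Bool
  | [] => none
  | (j, b) :: ρ => if j = i then some b else Restriction.get i ρ

/-- The input `x` with the bits of the restriction written over it. -/
def Restriction.apply (x : Fin n → Bool) : Restriction n → Fin n → Bool
  | [] => x
  | (i, b) :: ρ => Function.update (Restriction.apply x ρ) i b

/-- The mean of `f` over the inputs that agree with the restriction. -/
noncomputable def Restriction.mean (ρ : Restriction n) (f : (Fin n → Bool) → ℝ) : ℝ :=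
  𝔼 x, f (Restriction.apply x ρ)

namespace Restriction

theorem apply_of_get {ρ : Restriction n} {i : Fin n} {b : Bool} (h : get i ρ = some b)
    (x : Fin n → Bool) : apply x ρ i = b := by
  induction ρ with
  | nil => simp [get] at h
  | cons p ρ ih =>
    obtain ⟨j, c⟩ := p
    by_cases hj : j = i
    · subst hj; simpa [get, apply] using h
    · simp only [get, hj, if_false] at h
      simp [apply, Function.update_of_ne (Ne.symm hj), ih h]

theorem apply_update {ρ : Restriction n} {i : Fin n} (h : get i ρ = none)
    (x : Fin n → Bool) (b : Bool) : apply (Function.update x i b) ρ = apply x ((i, b) :: ρ) := by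
  induction ρ with
  | nil => rfl
  | cons p ρ ih =>
    obtain ⟨j, c⟩ := p
    by_cases hj : j = i
    · simp [get, hj] at h
    · simp only [get, hj, if_false] at h
      simp only [apply] at ih ⊢
      rw [ih h, Function.update_comm (Ne.symm hj)]

theorem expect_split (f : (Fin n → Bool) → ℝ) (i : Fin n) :
    𝔼 x, f x = ((𝔼 x, f (Function.update x i false)) + 𝔼 x, f (Function.update x i true)) / 2 := by
  -- flipping the bit `i` preserves the uniform distribution
  have hflip : 𝔼 x, f x = 𝔼 x, f (Function.update x i (!x i)) := by
    have hinv : Function.Involutive fun x : Fin n → Bool => Function.update x i (!x i) := by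
      intro x; simp
    exact Fintype.expect_equiv hinv.toPerm _ _ fun x => congrArg f (hinv x).symm
  have hsum : (𝔼 x, f x) + 𝔼 x, f (Function.update x i (!x i))
      = (𝔼 x, f (Function.update x i false)) + 𝔼 x, f (Function.update x i true) := by
    rw [← Finset.expect_add_distrib, ← Finset.expect_add_distrib]
    refine Finset.expect_congr rfl fun x _ => ?_
    have hx : Function.update x i (x i) = x := Function.update_eq_self i x
    cases h : x i <;> rw [h] at hx <;> simp [hx, add_comm]
  linarith

/-- The mean under a restriction that leaves `i` free is the average over the two values of `i`. -/
theorem mean_split {ρ : Restriction n} {i : Fin n} (h : get i ρ = none)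
    (f : (Fin n → Bool) → ℝ) :
    ρ.mean f = (mean ((i, false) :: ρ) f + mean ((i, true) :: ρ) f) / 2 := by
  unfold mean
  rw [expect_split _ i]
  simp only [apply_update h]

theorem mean_congr {ρ : Restriction n} {f g : (Fin n → Bool) → ℝ}
    (h : ∀ x, f (apply x ρ) = g (apply x ρ)) : ρ.mean f = ρ.mean g :=
  Finset.expect_congr rfl fun x _ => h x

theorem mean_add (ρ : Restriction n) (f g : (Fin n → Bool) → ℝ) :
    ρ.mean (fun x => f x + g x) = ρ.mean f + ρ.mean g := Finset.expect_add_distrib ..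

theorem mean_sub (ρ : Restriction n) (f g : (Fin n → Bool) → ℝ) :
    ρ.mean (fun x => f x - g x) = ρ.mean f - ρ.mean g := Finset.expect_sub_distrib ..

theorem mean_const_mul (ρ : Restriction n) (c : ℝ) (f : (Fin n → Bool) → ℝ) :
    ρ.mean (fun x => c * f x) = c * ρ.mean f := (Finset.mul_expect ..).symm

theorem mean_decision_of_get {ρ : Restriction n} {i : Fin n} {b : Bool} (h : get i ρ = some b)
    (R₀ R₁ : RDT n) (g : (Fin n → Bool) → ℝ) :
    ρ.mean (fun x => g x * (RDT.decision i R₀ R₁).mu x) =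
      ρ.mean (fun x => g x * (if b then R₁ else R₀).mu x) :=
  mean_congr fun x => by
    simp only [RDT.mu, apply_of_get h x]
    cases b <;> simp

theorem mean_decision_of_mem (ρ : Restriction n) (i : Fin n) (b : Bool)
    (R₀ R₁ : RDT n) (g : (Fin n → Bool) → ℝ) :
    mean ((i, b) :: ρ) (fun x => g x * (RDT.decision i R₀ R₁).mu x) =
      mean ((i, b) :: ρ) (fun x => g x * (if b then R₁ else R₀).mu x) :=
  mean_decision_of_get (by simp [get]) R₀ R₁ g

theorem mean_decision {ρ : Restriction n} {i : Fin n} (h : get i ρ = none)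
    (R₀ R₁ : RDT n) (g : (Fin n → Bool) → ℝ) :
    ρ.mean (fun x => g x * (RDT.decision i R₀ R₁).mu x) =
      (mean ((i, false) :: ρ) (fun x => g x * R₀.mu x) +
        mean ((i, true) :: ρ) (fun x => g x * R₁.mu x)) / 2 := by
  rw [mean_split h, mean_decision_of_mem, mean_decision_of_mem]
  simp

theorem mean_stochastic (ρ : Restriction n) (R₀ R₁ : RDT n) (g : (Fin n → Bool) → ℝ) :
    ρ.mean (fun x => g x * (RDT.stochastic R₀ R₁).mu x) =
      (ρ.mean (fun x => g x * R₀.mu x) + ρ.mean (fun x => g x * R₁.mu x)) / 2 := by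
  rw [← mean_add, div_eq_inv_mul, ← mean_const_mul]
  congr 1
  funext x
  simp only [RDT.mu]
  ring

end Restriction

/-- The sum of the deviations from `R` of the trees in the list `L`. -/
noncomputable def deviation (R : RDT n) (L : List (RDT n)) (x : Fin n → Bool) : ℝ :=
  (L.map fun T => T.mu x - R.mu x).sum

/-- The reason why greedy choices work: if a tree correlates with the deviation so far at most as
`R` does, adding it to the list increases the mean square of the deviation by at most `1`. -/
theorem mean_deviation_cons_sq_le (R T : RDT n) (L : List (RDT n))
    (h : Restriction.mean [] (fun x => deviation R L x * T.mu x) ≤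
      Restriction.mean [] (fun x => deviation R L x * R.mu x)) :
    Restriction.mean [] (fun x => deviation R (T :: L) x ^ 2) ≤
      Restriction.mean [] (fun x => deviation R L x ^ 2) + 1 := by
  have h1 : Restriction.mean ([] : Restriction n) (fun x => (T.mu x - R.mu x) ^ 2) ≤ 1 := by
    refine Finset.expect_le Finset.univ_nonempty fun x _ => ?_
    have a1 := T.mu_nonneg (Restriction.apply x [])
    have a2 := T.mu_le_one (Restriction.apply x [])
    have a3 := R.mu_nonneg (Restriction.apply x [])
    have a4 := R.mu_le_one (Restriction.apply x [])
    exact (sq_le_one_iff_abs_le_one _).2 (abs_le.2 ⟨by linarith, by linarith⟩)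
  have h2 : (fun x => deviation R (T :: L) x ^ 2) = fun x =>
      (deviation R L x ^ 2 + 2 * (deviation R L x * T.mu x - deviation R L x * R.mu x)) +
        (T.mu x - R.mu x) ^ 2 := by
    funext x
    simp only [deviation, List.map_cons, List.sum_cons]
    ring
  rw [h2, Restriction.mean_add, Restriction.mean_add, Restriction.mean_const_mul,
    Restriction.mean_sub]
  linarith

end Restrictions

/-! ### Conditional means of products of trees -/

section Trees

variable {n : ℕ}

/-- The datum for a list of trees. -/
def encodeTrees : List (RDT n) → Val
  | [] => .nil
  | R :: l => .cons R.encode (encodeTrees l)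

/-- The datum for a restriction. -/
def Restriction.encode : Restriction n → Val
  | [] => .nil
  | (i, b) :: ρ => .cons (.cons (.ofNat i) (.ofBool b)) (Restriction.encode ρ)

/-- The datum for an optional bit. -/
def encodeOption : Option Bool → Val
  | none => .nil
  | some b => .cons (.ofBool b) .nil

theorem RDT.descriptionLength_pos (R : RDT n) : 0 < R.descriptionLength := by
  cases R <;> simp [RDT.descriptionLength, RDT.encode, Val.size]

theorem RDT.descriptionLength_decision (i : Fin n) (R₀ R₁ : RDT n) :
    (RDT.decision i R₀ R₁).descriptionLength =
      (Val.ofNat i).size + R₀.descriptionLength + R₁.descriptionLength + 4 := by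
  simp only [RDT.descriptionLength, RDT.encode, Val.size]; omega

theorem RDT.descriptionLength_stochastic (R₀ R₁ : RDT n) :
    (RDT.stochastic R₀ R₁).descriptionLength =
      R₀.descriptionLength + R₁.descriptionLength + 7 := by
  simp only [RDT.descriptionLength, RDT.encode, Val.size]; omega

theorem RDT.isFrac_label (l : ℚ) (h₀ : 0 ≤ l) (h₁ : l ≤ 1) :
    IsFrac (.cons (.ofNat l.num.toNat) (.ofNat l.den)) (l : ℝ)
      (RDT.leaf (n := n) l h₀ h₁).descriptionLength := by
  refine ⟨_, _, rfl, ?_, ?_, ?_, ?_⟩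
  · rw [Val.toNat_ofNat]; exact l.den_nz
  · rw [Val.toNat_ofNat, Val.toNat_ofNat]
    have h : ((l.num.toNat : ℤ) : ℝ) = (l.num : ℝ) := by
      rw [Int.toNat_of_nonneg (Rat.num_nonneg.2 h₀)]
    rw [← Int.cast_natCast, h]
    exact_mod_cast (Rat.num_div_den l).symm
  · refine (Val.len_le_size _).trans ?_
    simp only [RDT.descriptionLength, RDT.encode, Val.size]; omega
  · refine (Val.len_le_size _).trans ?_
    simp only [RDT.descriptionLength, RDT.encode, Val.size]; omega

/-- A bound for the time of a lookup in a restriction with at most `K` entries. -/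
def lookupTime (K : ℕ) : ℕ := K * (160 * K + 200) + 20

theorem lookup_ev_aux {x d : ℕ → Bool} {K : ℕ} {i : Fin n} (hi : (Val.ofNat i).len ≤ K) :
    ∀ ρ : Restriction n, (∀ p ∈ ρ, (Val.ofNat p.1).len ≤ K) →
      Ev x d [.cons (.ofNat i) ρ.encode] Code.lookup (encodeOption (ρ.get i))
        (ρ.length * (160 * K + 200) + 20) 0 := by
  intro ρ
  induction ρ with
  | nil =>
    intro _
    exact (Ev.case_cons (.var rfl) (.case_nil (.var rfl) .nil)).le (by omega)
  | cons p ρ ih =>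
    intro hρ
    obtain ⟨j, b⟩ := p
    simp only [List.mem_cons, forall_eq_or_imp] at hρ
    have hr := ih hρ.2
    obtain ⟨v, hv, hs⟩ := eq_ev (x := x) (d := d) hρ.1 hi
    rw [Val.toNat_ofNat, Val.toNat_ofNat] at hs
    have hT : ((j, b) :: ρ).length * (160 * K + 200) + 20
        = (ρ.length * (160 * K + 200) + 20) + (160 * K + 200) := by
      simp only [List.length_cons]; ring
    rw [hT]
    -- the call whose value decides the next `case`, in the environment built so far
    have hc := Ev.call (f := 4) (env := [Val.ofNat j, Val.ofBool b,
      .cons (.ofNat j) (.ofBool b), Restriction.encode ρ, .ofNat i,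
      Restriction.encode ((j, b) :: ρ),
      .cons (.ofNat i) (Restriction.encode ((j, b) :: ρ))]) rfl
      (.cons (e₁ := .var 0) (e₂ := .var 4) (.var rfl) (.var rfl)) hv
    cases v with
    | nil =>
      have hne : j ≠ i := fun h => by simp [h] at hs
      simp only [Restriction.get, if_neg hne]
      exact (Ev.case_cons (.var rfl) (.case_cons (.var rfl) (.case_cons (.var rfl)
        (.case_nil hc (.call rfl (.cons (.var rfl) (.var rfl)) hr))))).le (by omega)
    | cons a c =>
      have he : j = i := Fin.ext (by simpa using hs)
      simp only [Restriction.get, if_pos he, encodeOption]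
      exact (Ev.case_cons (.var rfl) (.case_cons (.var rfl) (.case_cons (.var rfl)
        (.case_cons hc (.cons (.var rfl) .nil))))).le (by omega)

theorem lookup_ev {x d : ℕ → Bool} {K : ℕ} {i : Fin n} {ρ : Restriction n}
    (hi : (Val.ofNat i).len ≤ K) (hρ : ∀ p ∈ ρ, (Val.ofNat p.1).len ≤ K) (hK : ρ.length ≤ K) :
    Ev x d [.cons (.ofNat i) ρ.encode] Code.lookup (encodeOption (ρ.get i)) (lookupTime K) 0 :=
  (lookup_ev_aux hi ρ hρ).le (by unfold lookupTime; gcongr)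

/-- The product of the mean functions of a list of trees. -/
noncomputable def prodMu (l : List (RDT n)) (x : Fin n → Bool) : ℝ :=
  (l.map fun R => R.mu x).prod

theorem prodMu_cons (R : RDT n) (l : List (RDT n)) :
    prodMu (R :: l) = fun x => prodMu l x * R.mu x := by
  funext x; simp [prodMu, mul_comm]

/-- A bound both for the number of calls of `Code.prodMean` that a list of trees leads to, and for
the number of digits of the result. -/
def weight : List (RDT n) → ℕ
  | [] => 1
  | R :: l => R.descriptionLength * (1 + weight l)

/-- A bound for the time that one call of `Code.prodMean` takes outside of its recursive calls. -/
def prodCost (K : ℕ) : ℕ := lookupTime K + fracTime K + 200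

/-- The recurrence that makes `weight` a bound: a node costs its two branches and `2 * K` more. -/
theorem weight_node {s s₀ s₁ w K : ℕ} (h : s₀ + s₁ + 2 ≤ s) :
    s₀ * (1 + w) * K + s₁ * (1 + w) * K + 2 * K ≤ s * (1 + w) * K := by
  have : (s₀ + s₁ + 2) * (1 + w) * K ≤ s * (1 + w) * K := by gcongr
  nlinarith [Nat.zero_le (w * K)]

/-- `Code.prodMean` is correct and, per unit of `weight`, takes time `prodCost`. The recursion is on
the total size of the trees in the list, which leaves room for `ρ` to grow by one entry per
decision node. -/
theorem prodMean_ev {x d : ℕ → Bool} {K : ℕ} (s : ℕ) :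
    ∀ (l : List (RDT n)) (ρ : Restriction n),
    (l.map RDT.descriptionLength).sum < s → weight l ≤ K →
    ρ.length + (l.map RDT.descriptionLength).sum ≤ K → (∀ p ∈ ρ, (Val.ofNat p.1).len ≤ K) →
    ∃ v, Ev x d [.cons (encodeTrees l) ρ.encode] Code.prodMean v (weight l * prodCost K) 0 ∧
      IsFrac v (ρ.mean (prodMu l)) (weight l) := by
  induction s with
  | zero => intro l ρ hs; omega
  | succ s ih =>
    intro l ρ hs hw hK hρ
    cases l with
    | nil =>
      refine ⟨_, (Ev.case_cons (.var rfl) (.case_nil (.var rfl)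
        (.cons (.cons .one .nil) (.cons .one .nil)))).le ?_, ?_⟩
      · simp only [weight, prodCost]; omega
      · have : ρ.mean (prodMu []) = 1 := by
          simp [Restriction.mean, prodMu]
        rw [this]
        exact isFrac_one
    | cons R l =>
      simp only [List.map_cons, List.sum_cons, weight] at hs hw hK ⊢
      cases R with
      | leaf q h₀ h₁ =>
        set S := (RDT.leaf (n := n) q h₀ h₁).descriptionLength with hS
        have hSpos : 1 ≤ S := RDT.descriptionLength_pos _
        have hw' : S + weight l ≤ S * (1 + weight l) := by nlinarith
        obtain ⟨v, hv, hf⟩ := ih l ρ (by omega) (by omega) (by omega) hρ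
        obtain ⟨w, hw2, hf2⟩ := fmul_ev (x := x) (d := d) (K := K)
          (RDT.isFrac_label (n := n) q h₀ h₁) hf (by omega) (by omega)
        refine ⟨w, (Ev.case_cons (.var rfl) (.case_cons (.var rfl) (.case_cons (.var rfl)
          (.case_nil (.var rfl) (.call rfl (.cons (.var rfl)
            (.call rfl (.cons (.var rfl) (.var rfl)) hv)) hw2))))).le ?_, ?_⟩
        · have : (1 + weight l) * prodCost K ≤ S * (1 + weight l) * prodCost K := by
            gcongr; nlinarith
          rw [add_mul, one_mul] at this
          unfold prodCost at *
          omega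
        · have : ρ.mean (prodMu (RDT.leaf q h₀ h₁ :: l)) = q * ρ.mean (prodMu l) := by
            rw [prodMu_cons, ← Restriction.mean_const_mul]
            simp only [RDT.mu, mul_comm]
          rw [this]
          exact hf2.mono hw'
      | decision i R₀ R₁ =>
        set S := (RDT.decision i R₀ R₁).descriptionLength with hS
        rw [RDT.descriptionLength_decision] at hS
        have hi := (Val.ofNat i).len_le_size
        have hwt := weight_node (s := S) (s₀ := R₀.descriptionLength)
          (s₁ := R₁.descriptionLength) (w := weight l) (K := prodCost K) (by omega)
        have hwt1 := weight_node (s := S) (s₀ := R₀.descriptionLength)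
          (s₁ := R₁.descriptionLength) (w := weight l) (K := 1) (by omega)
        simp only [mul_one] at hwt1
        have hlk := lookup_ev (x := x) (d := d) (K := K) (i := i) (ρ := ρ) (by omega) hρ (by omega)
        -- the call whose value decides the next `case`, in the environment built so far
        have hc := Ev.call (f := 5) (env := [R₀.encode, R₁.encode, .nil, .ofNat i,
          .cons .nil (.ofNat i), .cons R₀.encode R₁.encode, (RDT.decision i R₀ R₁).encode,
          encodeTrees l, encodeTrees (.decision i R₀ R₁ :: l), ρ.encode,
          .cons (encodeTrees (.decision i R₀ R₁ :: l)) ρ.encode]) rfl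
          (.cons (e₁ := .var 3) (e₂ := .var 9) (.var rfl) (.var rfl)) hlk
        cases hg : ρ.get i with
        | none =>
          rw [hg] at hc
          have hρ' : ∀ b, ∀ p ∈ (i, b) :: ρ, (Val.ofNat p.1).len ≤ K := by
            intro b p hp
            rcases List.mem_cons.1 hp with rfl | hp
            · show (Val.ofNat i).len ≤ K
              omega
            · exact hρ p hp
          obtain ⟨v₀, hv₀, hf₀⟩ := ih (R₀ :: l) ((i, false) :: ρ)
            (by simp only [List.map_cons, List.sum_cons]; omega)
            (by simp only [weight]; omega)
            (by simp only [List.map_cons, List.sum_cons, List.length_cons]; omega) (hρ' _)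
          obtain ⟨v₁, hv₁, hf₁⟩ := ih (R₁ :: l) ((i, true) :: ρ)
            (by simp only [List.map_cons, List.sum_cons]; omega)
            (by simp only [weight]; omega)
            (by simp only [List.map_cons, List.sum_cons, List.length_cons]; omega) (hρ' _)
          simp only [weight] at hv₀ hv₁ hf₀ hf₁
          obtain ⟨w, hw2, hf2⟩ := favg_ev (x := x) (d := d) (K := K) hf₀ hf₁ (by omega) (by omega)
          refine ⟨w, (Ev.case_cons (.var rfl) (.case_cons (.var rfl) (.case_cons (.var rfl)
            (.case_cons (.var rfl) (.case_cons (.var rfl) (.case_nil (.var rfl)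
              (.case_nil hc (.call rfl (.cons
                (.call rfl (.cons (.cons (.var rfl) (.var rfl))
                  (.cons (.cons (.var rfl) .nil) (.var rfl))) hv₀)
                (.call rfl (.cons (.cons (.var rfl) (.var rfl))
                  (.cons (.cons (.var rfl) .one) (.var rfl))) hv₁)) hw2)))))))).le ?_, ?_⟩
          · have : prodCost K = lookupTime K + fracTime K + 200 := rfl
            omega
          · rw [prodMu_cons, Restriction.mean_decision hg, ← prodMu_cons, ← prodMu_cons]
            exact hf2.mono (by omega)
        | some b =>
          rw [hg] at hc
          have hmean : ρ.mean (prodMu (RDT.decision i R₀ R₁ :: l)) =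
              ρ.mean (prodMu ((if b then R₁ else R₀) :: l)) := by
            rw [prodMu_cons, Restriction.mean_decision_of_get hg, ← prodMu_cons]
          rw [hmean]
          obtain ⟨v, hv, hf⟩ := ih ((if b then R₁ else R₀) :: l) ρ
            (by cases b <;> simp <;> omega)
            (by cases b <;> simp only [weight] <;> simp <;> omega)
            (by cases b <;> simp <;> omega) hρ
          simp only [weight] at hv hf
          have : prodCost K = lookupTime K + fracTime K + 200 := rfl
          cases b with
          | false =>
            simp only [Bool.false_eq_true, if_false] at hv hf ⊢
            exact ⟨v, (Ev.case_cons (.var rfl) (.case_cons (.var rfl) (.case_cons (.var rfl)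
              (.case_cons (.var rfl) (.case_cons (.var rfl) (.case_nil (.var rfl)
                (.case_cons hc (.case_nil (.var rfl)
                  (.call rfl (.cons (.cons (.var rfl) (.var rfl)) (.var rfl)) hv))))))))).le
                    (by omega), hf.mono (by omega)⟩
          | true =>
            simp only [if_true] at hv hf ⊢
            exact ⟨v, (Ev.case_cons (.var rfl) (.case_cons (.var rfl) (.case_cons (.var rfl)
              (.case_cons (.var rfl) (.case_cons (.var rfl) (.case_nil (.var rfl)
                (.case_cons hc (.case_cons (.var rfl)
                  (.call rfl (.cons (.cons (.var rfl) (.var rfl)) (.var rfl)) hv))))))))).le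
                    (by omega), hf.mono (by omega)⟩
      | stochastic R₀ R₁ =>
        set S := (RDT.stochastic R₀ R₁).descriptionLength with hS
        rw [RDT.descriptionLength_stochastic] at hS
        have hwt := weight_node (s := S) (s₀ := R₀.descriptionLength)
          (s₁ := R₁.descriptionLength) (w := weight l) (K := prodCost K) (by omega)
        have hwt1 := weight_node (s := S) (s₀ := R₀.descriptionLength)
          (s₁ := R₁.descriptionLength) (w := weight l) (K := 1) (by omega)
        simp only [mul_one] at hwt1
        obtain ⟨v₀, hv₀, hf₀⟩ := ih (R₀ :: l) ρ
          (by simp only [List.map_cons, List.sum_cons]; omega)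
          (by simp only [weight]; omega)
          (by simp only [List.map_cons, List.sum_cons]; omega) hρ
        obtain ⟨v₁, hv₁, hf₁⟩ := ih (R₁ :: l) ρ
          (by simp only [List.map_cons, List.sum_cons]; omega)
          (by simp only [weight]; omega)
          (by simp only [List.map_cons, List.sum_cons]; omega) hρ
        simp only [weight] at hv₀ hv₁ hf₀ hf₁
        obtain ⟨w, hw2, hf2⟩ := favg_ev (x := x) (d := d) (K := K) hf₀ hf₁ (by omega) (by omega)
        refine ⟨w, (Ev.case_cons (.var rfl) (.case_cons (.var rfl) (.case_cons (.var rfl)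
          (.case_cons (.var rfl) (.case_cons (.var rfl) (.case_cons (.var rfl)
            (.call rfl (.cons
              (.call rfl (.cons (.cons (.var rfl) (.var rfl)) (.var rfl)) hv₀)
              (.call rfl (.cons (.cons (.var rfl) (.var rfl)) (.var rfl)) hv₁))
                hw2))))))).le ?_, ?_⟩
        · have : prodCost K = lookupTime K + fracTime K + 200 := rfl
          omega
        · rw [prodMu_cons, Restriction.mean_stochastic, ← prodMu_cons, ← prodMu_cons]
          exact hf2.mono (by omega)

/-! ### Choosing the deterministic trees -/

/-- A bound for the weight of a pair of trees of description length at most `K`. -/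
def pairWeight (K : ℕ) : ℕ := K * (1 + K * 2)

/-- A bound for the parameters of a call of `Code.prodMean` on a pair of trees of description
length at most `K`. -/
def pairBound (K : ℕ) : ℕ := 3 * K * (K + 1)

theorem prodMean_pair_ev {x d : ℕ → Bool} {K : ℕ} {A B : RDT n} {ρ : Restriction n}
    (hA : A.descriptionLength ≤ K) (hB : B.descriptionLength ≤ K) (hρ : ρ.length ≤ K)
    (hρ' : ∀ p ∈ ρ, (Val.ofNat p.1).len ≤ K) :
    ∃ v, Ev x d [.cons (.cons A.encode (.cons B.encode .nil)) ρ.encode] Code.prodMean v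
        (pairWeight K * prodCost (pairBound K)) 0 ∧
      IsFrac v (ρ.mean fun x => A.mu x * B.mu x) (pairWeight K) := by
  have hw : weight [A, B] ≤ pairWeight K := by
    simp only [weight, pairWeight]; gcongr
  have hK : K ≤ pairBound K := by unfold pairBound; nlinarith
  obtain ⟨v, hv, hf⟩ := prodMean_ev (x := x) (d := d) (K := pairBound K) _ [A, B] ρ
    (Nat.lt_succ_self _) (hw.trans (by unfold pairWeight pairBound; nlinarith))
    (by
      have : 3 * K ≤ pairBound K := by unfold pairBound; nlinarith
      simp only [List.map_cons, List.map_nil, List.sum_cons, List.sum_nil]; omega)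
    (fun p hp => (hρ' p hp).trans hK)
  refine ⟨v, hv.le (by gcongr), ?_⟩
  have : prodMu [A, B] = fun x => A.mu x * B.mu x := by
    funext x; simp [prodMu]
  rw [← this]
  exact hf.mono hw

/-- The sum that `Code.corr` computes. -/
noncomputable def corrSum (R : RDT n) (ρ : Restriction n) (A B : RDT n) (L : List (RDT n)) : ℝ :=
  (L.map fun T => ρ.mean (fun x => T.mu x * A.mu x) + ρ.mean (fun x => R.mu x * B.mu x)).sum

/-- Comparing two values of `corrSum` compares the correlations of two trees with the deviation;
in this form, no negative numbers occur. -/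
theorem corrSum_sub (R : RDT n) (ρ : Restriction n) (A B : RDT n) (L : List (RDT n)) :
    corrSum R ρ A B L - corrSum R ρ B A L =
      ρ.mean (fun x => deviation R L x * A.mu x) - ρ.mean (fun x => deviation R L x * B.mu x) := by
  induction L with
  | nil => simp [corrSum, deviation]
  | cons T L ih =>
    have h : ∀ A : RDT n, ρ.mean (fun x => deviation R (T :: L) x * A.mu x) =
        (ρ.mean (fun x => T.mu x * A.mu x) - ρ.mean (fun x => R.mu x * A.mu x)) +
          ρ.mean (fun x => deviation R L x * A.mu x) := by
      intro A
      rw [← Restriction.mean_sub, ← Restriction.mean_add]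
      congr 1
      funext x
      simp only [deviation, List.map_cons, List.sum_cons]
      ring
    rw [h A, h B]
    simp only [corrSum, List.map_cons, List.sum_cons] at ih ⊢
    linarith

/-- A bound for the number of digits of a sum over at most `K` trees of fractions with at most `B`
digits. -/
def sumBound (K B : ℕ) : ℕ := 1 + K * (2 * B + 2)

/-- A bound for the time that `Code.corr` spends on one tree of the list. -/
def corrCost (K : ℕ) : ℕ :=
  2 * (pairWeight K * prodCost (pairBound K)) + 2 * fracTime (sumBound K (pairWeight K)) + 200

/-- `Code.corr` computes `corrSum`. -/
theorem corr_ev {x d : ℕ → Bool} {K : ℕ} {R A B : RDT n} {ρ : Restriction n}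
    (hR : R.descriptionLength ≤ K) (hA : A.descriptionLength ≤ K) (hB : B.descriptionLength ≤ K)
    (hρ : ρ.length ≤ K) (hρ' : ∀ p ∈ ρ, (Val.ofNat p.1).len ≤ K) :
    ∀ L : List (RDT n), L.length ≤ K → (∀ T ∈ L, T.descriptionLength ≤ K) →
    ∃ v, Ev x d [.cons (encodeTrees L) (.cons A.encode (.cons B.encode
        (.cons R.encode ρ.encode)))] Code.corr v ((L.length + 1) * corrCost K) 0 ∧
      IsFrac v (corrSum R ρ A B L) (sumBound L.length (pairWeight K)) := by
  intro L
  induction L with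
  | nil =>
    intro _ _
    exact ⟨_, (Ev.case_cons (.var rfl) (.case_nil (.var rfl)
      (.cons .nil (.cons .one .nil)))).le (by simp only [corrCost, List.length_nil]; omega),
      by simpa [corrSum, sumBound] using isFrac_zero⟩
  | cons T L ih =>
    intro hL hT
    simp only [List.mem_cons, forall_eq_or_imp] at hT
    simp only [List.length_cons] at hL ⊢
    obtain ⟨v, hv, hf⟩ := ih (by omega) hT.2
    obtain ⟨v₁, hv₁, hf₁⟩ := prodMean_pair_ev (x := x) (d := d) hT.1 hA hρ hρ'
    obtain ⟨v₂, hv₂, hf₂⟩ := prodMean_pair_ev (x := x) (d := d) hR hB hρ hρ'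
    have hb : sumBound (L.length + 1) (pairWeight K) ≤ sumBound K (pairWeight K) := by
      unfold sumBound; gcongr
    have hb' : sumBound (L.length + 1) (pairWeight K) =
        sumBound L.length (pairWeight K) + (2 * pairWeight K + 2) := by
      unfold sumBound; ring
    obtain ⟨v₃, hv₃, hf₃⟩ := fadd_ev (x := x) (d := d) (K := sumBound K (pairWeight K)) hf₂ hf
      (by omega) (by omega)
    obtain ⟨v₄, hv₄, hf₄⟩ := fadd_ev (x := x) (d := d) (K := sumBound K (pairWeight K)) hf₁ hf₃
      (by omega) (by omega)
    refine ⟨v₄, (Ev.case_cons (.var rfl) (.case_cons (.var rfl) (.case_cons (.var rfl)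
      (.case_cons (.var rfl) (.case_cons (.var rfl) (.call rfl (.cons
        (.call rfl (.cons (.cons (.var rfl) (.cons (.var rfl) .nil)) (.var rfl)) hv₁)
        (.call rfl (.cons
          (.call rfl (.cons (.cons (.var rfl) (.cons (.var rfl) .nil)) (.var rfl)) hv₂)
          (.call rfl (.cons (.var rfl) (.var rfl)) hv)) hv₃)) hv₄)))))).le ?_, ?_⟩
    · have : corrCost K = 2 * (pairWeight K * prodCost (pairBound K)) +
        2 * fracTime (sumBound K (pairWeight K)) + 200 := rfl
      rw [Nat.succ_mul (L.length + 1)]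
      omega
    · have : corrSum R ρ A B (T :: L) = ρ.mean (fun x => T.mu x * A.mu x) +
          (ρ.mean (fun x => R.mu x * B.mu x) + corrSum R ρ A B L) := by
        simp only [corrSum, List.map_cons, List.sum_cons]; ring
      rw [this]
      exact hf₄.mono (by omega)

/-- A bound for the time that one call of `Code.resolve` takes outside of its recursive calls. -/
def resolveCost (K : ℕ) : ℕ :=
  lookupTime K + 2 * ((K + 1) * corrCost K) + fracTime (sumBound K (pairWeight K)) + 200

/-- The method of conditional expectations: `Code.resolve` turns `R'` into a deterministic tree
whose correlation with the deviation is not larger than that of `R'`. -/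
theorem resolve_ev {x d : ℕ → Bool} {K : ℕ} {R : RDT n} {L : List (RDT n)}
    (hR : R.descriptionLength ≤ K) (hL : L.length ≤ K)
    (hL' : ∀ T ∈ L, T.descriptionLength ≤ K) (R' : RDT n) :
    ∀ ρ : Restriction n, ρ.length + R'.descriptionLength ≤ K →
    (∀ p ∈ ρ, (Val.ofNat p.1).len ≤ K) →
    ∃ T : RDT n, Ev x d [.cons R'.encode (.cons ρ.encode (.cons R.encode (encodeTrees L)))]
        Code.resolve T.encode (R'.descriptionLength * resolveCost K) 0 ∧
      T.descriptionLength ≤ R'.descriptionLength ∧ T.queryComplexity ≤ R'.queryComplexity ∧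
      T.randomnessComplexity = 0 ∧
      ρ.mean (fun x => deviation R L x * T.mu x) ≤ ρ.mean (fun x => deviation R L x * R'.mu x) := by
  induction R' with
  | leaf q h₀ h₁ =>
    intro ρ _ _
    refine ⟨.leaf q h₀ h₁, (Ev.case_cons (.var rfl) (.case_cons (.var rfl) (.case_cons (.var rfl)
      (.case_nil (.var rfl) (.var rfl))))).le ?_, le_rfl, le_rfl, rfl, le_rfl⟩
    have h1 := Nat.mul_le_mul_right (resolveCost K)
      (RDT.descriptionLength_pos (RDT.leaf (n := n) q h₀ h₁))
    have : resolveCost K ≥ 200 := by unfold resolveCost; omega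
    omega
  | decision i R₀ R₁ ih₀ ih₁ =>
    intro ρ hK hρ
    have hi := (Val.ofNat i).len_le_size
    rw [RDT.descriptionLength_decision] at hK ⊢
    have hT : R₀.descriptionLength * resolveCost K + R₁.descriptionLength * resolveCost K +
        resolveCost K ≤ ((Val.ofNat i).size + R₀.descriptionLength + R₁.descriptionLength + 4) *
          resolveCost K := by
      rw [← Nat.add_mul, ← Nat.succ_mul]; gcongr; omega
    have hlk := lookup_ev (x := x) (d := d) (K := K) (i := i) (ρ := ρ) (by omega) hρ (by omega)
    -- the call whose value decides the next `case`, in the environment built so far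
    have hc := Ev.call (f := 5) (env := [R₀.encode, R₁.encode, .nil, .ofNat i,
      .cons .nil (.ofNat i), .cons R₀.encode R₁.encode, ρ.encode, .cons R.encode (encodeTrees L),
      (RDT.decision i R₀ R₁).encode, .cons ρ.encode (.cons R.encode (encodeTrees L)),
      .cons (RDT.decision i R₀ R₁).encode (.cons ρ.encode (.cons R.encode (encodeTrees L)))]) rfl
      (.cons (e₁ := .var 3) (e₂ := .var 6) (.var rfl) (.var rfl)) hlk
    have hcost : resolveCost K = lookupTime K + 2 * ((K + 1) * corrCost K) +
      fracTime (sumBound K (pairWeight K)) + 200 := rfl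
    cases hg : ρ.get i with
    | none =>
      rw [hg] at hc
      have hρ' : ∀ b, ∀ p ∈ (i, b) :: ρ, (Val.ofNat p.1).len ≤ K := by
        intro b p hp
        rcases List.mem_cons.1 hp with rfl | hp
        · show (Val.ofNat i).len ≤ K
          omega
        · exact hρ p hp
      obtain ⟨T₀, hv₀, hs₀, hq₀, hr₀, hm₀⟩ := ih₀ ((i, false) :: ρ)
        (by simp only [List.length_cons]; omega) (hρ' _)
      obtain ⟨T₁, hv₁, hs₁, hq₁, hr₁, hm₁⟩ := ih₁ ((i, true) :: ρ)
        (by simp only [List.length_cons]; omega) (hρ' _)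
      refine ⟨.decision i T₀ T₁, (Ev.case_cons (.var rfl) (.case_cons (.var rfl)
        (.case_cons (.var rfl) (.case_cons (.var rfl) (.case_cons (.var rfl)
          (.case_nil (.var rfl) (.case_nil hc (.cons (.var rfl) (.cons
            (.call rfl (.cons (.var rfl) (.cons (.cons (.cons (.var rfl) .nil) (.var rfl))
              (.var rfl))) hv₀)
            (.call rfl (.cons (.var rfl) (.cons (.cons (.cons (.var rfl) .one) (.var rfl))
              (.var rfl))) hv₁)))))))))).le ?_, ?_, ?_, ?_, ?_⟩
      · omega
      · rw [RDT.descriptionLength_decision]; omega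
      · simp only [RDT.queryComplexity]; omega
      · simp only [RDT.randomnessComplexity]; omega
      · rw [Restriction.mean_decision hg, Restriction.mean_decision hg]
        linarith
    | some b =>
      rw [hg] at hc
      rw [Restriction.mean_decision_of_get hg]
      cases b with
      | false =>
        obtain ⟨T, hv, hs, hq, hr, hm⟩ := ih₀ ρ (by omega) hρ
        exact ⟨T, (Ev.case_cons (.var rfl) (.case_cons (.var rfl)
          (.case_cons (.var rfl) (.case_cons (.var rfl) (.case_cons (.var rfl)
            (.case_nil (.var rfl) (.case_cons hc (.case_nil (.var rfl)
              (.call rfl (.cons (.var rfl) (.cons (.var rfl) (.var rfl))) hv))))))))).le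
                (by omega), by omega, by simp only [RDT.queryComplexity]; omega, hr,
                  by simpa using hm⟩
      | true =>
        obtain ⟨T, hv, hs, hq, hr, hm⟩ := ih₁ ρ (by omega) hρ
        exact ⟨T, (Ev.case_cons (.var rfl) (.case_cons (.var rfl)
          (.case_cons (.var rfl) (.case_cons (.var rfl) (.case_cons (.var rfl)
            (.case_nil (.var rfl) (.case_cons hc (.case_cons (.var rfl)
              (.call rfl (.cons (.var rfl) (.cons (.var rfl) (.var rfl))) hv))))))))).le
                (by omega), by omega, by simp only [RDT.queryComplexity]; omega, hr,
                  by simpa using hm⟩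
  | stochastic R₀ R₁ ih₀ ih₁ =>
    intro ρ hK hρ
    rw [RDT.descriptionLength_stochastic] at hK ⊢
    have hT : R₀.descriptionLength * resolveCost K + R₁.descriptionLength * resolveCost K +
        resolveCost K ≤ (R₀.descriptionLength + R₁.descriptionLength + 7) *
          resolveCost K := by
      rw [← Nat.add_mul, ← Nat.succ_mul]; gcongr; omega
    have hcost : resolveCost K = lookupTime K + 2 * ((K + 1) * corrCost K) +
      fracTime (sumBound K (pairWeight K)) + 200 := rfl
    obtain ⟨v₀, hv₀, hf₀⟩ := corr_ev (x := x) (d := d) (K := K) (A := R₀) (B := R₁) (ρ := ρ) hR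
      (by omega) (by omega) (by omega) hρ L hL hL'
    obtain ⟨v₁, hv₁, hf₁⟩ := corr_ev (x := x) (d := d) (K := K) (A := R₁) (B := R₀) (ρ := ρ) hR
      (by omega) (by omega) (by omega) hρ L hL hL'
    have hb : sumBound L.length (pairWeight K) ≤ sumBound K (pairWeight K) := by
      unfold sumBound; gcongr
    have hcl : (L.length + 1) * corrCost K ≤ (K + 1) * corrCost K := by gcongr
    obtain ⟨u, hu, hle⟩ := fle_ev (x := x) (d := d) hf₀ hf₁ hb hb
    have hsub := corrSum_sub R ρ R₀ R₁ L
    -- the call whose value decides the next `case`, in the environment built so far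
    have hc := Ev.call (f := 9) (env := [R.encode, encodeTrees L, .nil, .nil, R₀.encode, R₁.encode,
      .cons .nil .nil, .nil, .cons (.cons .nil .nil) .nil, .cons R₀.encode R₁.encode, ρ.encode,
      .cons R.encode (encodeTrees L),
      (RDT.stochastic R₀ R₁).encode, .cons ρ.encode (.cons R.encode (encodeTrees L)),
      .cons (RDT.stochastic R₀ R₁).encode (.cons ρ.encode (.cons R.encode (encodeTrees L)))]) rfl
      (.cons (.call (f := 11) (e := .cons (.var 1) (.cons (.var 4) (.cons (.var 5)
          (.cons (.var 0) (.var 10))))) rfl (.cons (.var rfl) (.cons (.var rfl)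
            (.cons (.var rfl) (.cons (.var rfl) (.var rfl))))) hv₀)
        (.call (f := 11) (e := .cons (.var 1) (.cons (.var 5) (.cons (.var 4)
          (.cons (.var 0) (.var 10))))) rfl (.cons (.var rfl) (.cons (.var rfl)
            (.cons (.var rfl) (.cons (.var rfl) (.var rfl))))) hv₁)) hu
    rw [Restriction.mean_stochastic]
    cases u with
    | nil =>
      have hlt : corrSum R ρ R₁ R₀ L < corrSum R ρ R₀ R₁ L := by simpa using hle
      obtain ⟨T, hv, hs, hq, hr, hm⟩ := ih₁ ρ (by omega) hρ
      exact ⟨T, (Ev.case_cons (.var rfl) (.case_cons (.var rfl)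
        (.case_cons (.var rfl) (.case_cons (.var rfl) (.case_cons (.var rfl)
          (.case_cons (.var rfl) (.case_cons (.var rfl) (.case_nil hc
            (.call rfl (.cons (.var rfl) (.cons (.var rfl) (.var rfl))) hv))))))))).le
              (by omega), by omega, by simp only [RDT.queryComplexity]; omega, hr, by linarith⟩
    | cons a b =>
      have hle' : corrSum R ρ R₀ R₁ L ≤ corrSum R ρ R₁ R₀ L := by simpa using hle
      obtain ⟨T, hv, hs, hq, hr, hm⟩ := ih₀ ρ (by omega) hρ
      exact ⟨T, (Ev.case_cons (.var rfl) (.case_cons (.var rfl)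
        (.case_cons (.var rfl) (.case_cons (.var rfl) (.case_cons (.var rfl)
          (.case_cons (.var rfl) (.case_cons (.var rfl) (.case_cons hc
            (.call rfl (.cons (.var rfl) (.cons (.var rfl) (.var rfl))) hv))))))))).le
              (by omega), by omega, by simp only [RDT.queryComplexity]; omega, hr, by linarith⟩


/-- The numeral for `2 ^ j`. -/
def powVal : ℕ → Val
  | 0 => .cons (.ofBool true) .nil
  | j + 1 => .cons .nil (powVal j)

theorem toNat_powVal (j : ℕ) : (powVal j).toNat = 2 ^ j := by
  induction j with
  | zero => rfl
  | succ j ih => simp only [powVal, Val.toNat, ih, pow_succ]; omega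

theorem len_powVal (j : ℕ) : (powVal j).len = j + 1 := by
  induction j with
  | zero => rfl
  | succ j ih => simp only [powVal, Val.len, ih]

/-- The list `L` consists of deterministic trees that are no larger and make no more queries than
the tree `R`. -/
def Derandomizes (R : RDT n) (L : List (RDT n)) : Prop :=
  ∀ T ∈ L, T.descriptionLength ≤ R.descriptionLength ∧
    T.queryComplexity ≤ R.queryComplexity ∧ T.randomnessComplexity = 0

/-- A bound for the time per tree of `Code.greedy`. -/
def greedyCost (K : ℕ) : ℕ := K * resolveCost K + 200

/-- After `2 ^ j` greedy steps the mean square of the deviation has grown by at most `2 ^ j`. -/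
theorem greedy_ev {x d : ℕ → Bool} {K : ℕ} {R : RDT n} (hR : R.descriptionLength ≤ K) (j : ℕ) :
    ∀ L : List (RDT n), L.length + 2 ^ j ≤ K → Derandomizes R L →
    ∃ L' : List (RDT n), Ev x d [.cons (powVal j) (.cons R.encode (encodeTrees L))] Code.greedy
        (encodeTrees L') (2 * (2 ^ j * greedyCost K) - greedyCost K) 0 ∧
      Derandomizes R L' ∧ L'.length = L.length + 2 ^ j ∧
      Restriction.mean [] (fun x => deviation R L' x ^ 2) ≤
        Restriction.mean [] (fun x => deviation R L x ^ 2) + 2 ^ j := by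
  have hcost : greedyCost K = K * resolveCost K + 200 := rfl
  induction j with
  | zero =>
    intro L hL hD
    obtain ⟨T, hv, hs, hq, hr, hm⟩ := resolve_ev (x := x) (d := d) hR (L := L) (by omega)
      (fun T hT => ((hD T hT).1).trans hR) R [] (by simpa using hR) (by simp)
    have hT : R.descriptionLength * resolveCost K ≤ K * resolveCost K := by gcongr
    refine ⟨T :: L, (Ev.case_cons (.var rfl) (.case_cons (.var rfl) (.case_cons (.var rfl)
      (.case_cons (.var rfl) (.cons (.call rfl (.cons (.var rfl) (.cons .nil (.var rfl))) hv)
        (.var rfl)))))).le (by omega), ?_, by simp, ?_⟩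
    · intro T' hT'
      rcases List.mem_cons.1 hT' with rfl | hT'
      · exact ⟨hs, hq, hr⟩
      · exact hD T' hT'
    · simpa using mean_deviation_cons_sq_le R T L hm
  | succ j ih =>
    intro L hL hD
    rw [pow_succ] at hL
    obtain ⟨L₁, hv₁, hD₁, hl₁, hm₁⟩ := ih L (by omega) hD
    obtain ⟨L₂, hv₂, hD₂, hl₂, hm₂⟩ := ih L₁ (by omega) hD₁
    have hpos : greedyCost K ≤ 2 ^ j * greedyCost K :=
      Nat.le_mul_of_pos_left _ (by positivity)
    have hpow : 2 ^ (j + 1) * greedyCost K = 2 * (2 ^ j * greedyCost K) := by ring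
    -- two rounds take `2 * (2 * 2 ^ j - 1) * greedyCost K`; the subtracted term pays for the rest
    refine ⟨L₂, (Ev.case_cons (.var rfl) (.case_cons (.var rfl) (.case_cons (.var rfl)
      (.case_nil (.var rfl) (.call rfl (.cons (.var rfl) (.cons (.var rfl)
        (.call rfl (.cons (.var rfl) (.var rfl)) hv₁))) hv₂))))).le (by omega), hD₂,
          by rw [hl₂, hl₁, pow_succ]; omega, ?_⟩
    rw [pow_succ]
    linarith

/-! ### Evaluation on the input -/

/-- Only this part of the program queries the input, at most once per decision node on the path. -/
theorem evalTree_ev {d : ℕ → Bool} (x : Fin n → Bool) (T : RDT n)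
    (hT : T.randomnessComplexity = 0) :
    ∃ v, Ev (padBits x) d [T.encode] Code.evalTree v (20 * T.descriptionLength)
        T.queryComplexity ∧ IsFrac v (T.mu x) T.descriptionLength := by
  induction T with
  | leaf q h₀ h₁ =>
    have := RDT.descriptionLength_pos (RDT.leaf (n := n) q h₀ h₁)
    exact ⟨_, (Ev.case_cons (.var rfl) (.case_nil (.var rfl) (.var rfl))).mono (by omega)
      (by simp), RDT.isFrac_label q h₀ h₁⟩
  | decision i R₀ R₁ ih₀ ih₁ =>
    simp only [RDT.randomnessComplexity] at hT
    have hx : padBits x (Val.ofNat i).toNat = x i := by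
      rw [Val.toNat_ofNat, padBits, dif_pos i.2]
    have hq := Ev.query (Ev.var (x := padBits x) (d := d) (env := [R₀.encode, R₁.encode, .nil,
      .ofNat i, .cons .nil (.ofNat i), .cons R₀.encode R₁.encode,
      (RDT.decision i R₀ R₁).encode]) (i := 3) rfl)
    rw [hx] at hq
    rw [RDT.descriptionLength_decision]
    cases hb : x i with
    | false =>
      obtain ⟨v, hv, hf⟩ := ih₀ (by omega)
      rw [hb] at hq
      exact ⟨v, (Ev.case_cons (.var rfl) (.case_cons (.var rfl) (.case_cons (.var rfl)
        (.case_nil hq (.call rfl (.var rfl) hv))))).mono (by omega)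
          (by simp only [RDT.queryComplexity]; omega),
          by simpa [RDT.mu, hb] using hf.mono (by omega)⟩
    | true =>
      obtain ⟨v, hv, hf⟩ := ih₁ (by omega)
      rw [hb] at hq
      exact ⟨v, (Ev.case_cons (.var rfl) (.case_cons (.var rfl) (.case_cons (.var rfl)
        (.case_cons hq (.call rfl (.var rfl) hv))))).mono (by omega)
          (by simp only [RDT.queryComplexity]; omega),
          by simpa [RDT.mu, hb] using hf.mono (by omega)⟩
  | stochastic R₀ R₁ => simp [RDT.randomnessComplexity] at hT

/-- A bound for the time per tree of `Code.evalSum`. -/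
def evalCost (K : ℕ) : ℕ := 20 * K + fracTime (sumBound K K) + 100

theorem evalSum_ev {d : ℕ → Bool} (x : Fin n → Bool) {K : ℕ} {R : RDT n}
    (hR : R.descriptionLength ≤ K) :
    ∀ L : List (RDT n), L.length ≤ K → Derandomizes R L →
    ∃ v, Ev (padBits x) d [encodeTrees L] Code.evalSum v ((L.length + 1) * evalCost K)
        (L.length * R.queryComplexity) ∧
      IsFrac v (L.map fun T => T.mu x).sum (sumBound L.length K) := by
  intro L
  induction L with
  | nil =>
    intro _ _
    exact ⟨_, (Ev.case_nil (.var rfl) (.cons .nil (.cons .one .nil))).mono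
      (by simp only [evalCost, List.length_nil]; omega) (by simp),
      by simpa [sumBound] using isFrac_zero⟩
  | cons T L ih =>
    intro hL hD
    simp only [List.length_cons] at hL ⊢
    have hT := hD T (by simp)
    obtain ⟨v, hv, hf⟩ := ih (by omega) (fun T' hT' => hD T' (by simp [hT']))
    obtain ⟨w, hw, hg⟩ := evalTree_ev (d := d) x T hT.2.2
    have hb : sumBound (L.length + 1) K ≤ sumBound K K := by
      unfold sumBound; gcongr
    have hb' : sumBound (L.length + 1) K = sumBound L.length K + (2 * K + 2) := by
      unfold sumBound; ring
    obtain ⟨u, hu, hh⟩ := fadd_ev (x := padBits x) (d := d) (K := sumBound K K) hg hf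
      (by omega) (by omega)
    refine ⟨u, (Ev.case_cons (.var rfl) (.call rfl (.cons (.call rfl (.var rfl) hw)
      (.call rfl (.var rfl) hv)) hu)).mono ?_ ?_, ?_⟩
    · have : evalCost K = 20 * K + fracTime (sumBound K K) + 100 := rfl
      rw [Nat.succ_mul (L.length + 1)]
      omega
    · rw [Nat.succ_mul]; omega
    · rw [List.map_cons, List.sum_cons]
      exact hh.mono (by omega)

/-! ### The digits of the error parameter -/

/-- If `J` is the position of the first digit `1`, the search started at position `0` with the
numeral `2` ends with the numeral `2 ^ (J + 1)`. -/
theorem find_ev {x d : ℕ → Bool} {J : ℕ} (hJ : d J = true) (hlt : ∀ j < J, d j = false) (k : ℕ) :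
    ∀ (j : ℕ) (i : Val), j + k = J → i.toNat = j → i.len ≤ j →
    Ev x d [.cons i (powVal (j + 1))] Code.find (powVal (J + 1)) ((k + 1) * (20 * J + 60)) 0 := by
  induction k with
  | zero =>
    intro j i hj hi hl
    have hd := Ev.digit (Ev.var (x := x) (d := d) (v := i)
      (env := [i, powVal (j + 1), .cons i (powVal (j + 1))]) (i := 0) rfl)
    obtain rfl : j = J := by omega
    rw [hi, hJ] at hd
    exact (Ev.case_cons (.var rfl) (.case_cons hd (.var rfl))).le (by omega)
  | succ k ih =>
    intro j i hj hi hl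
    have hd := Ev.digit (Ev.var (x := x) (d := d) (v := i)
      (env := [i, powVal (j + 1), .cons i (powVal (j + 1))]) (i := 0) rfl)
    rw [hi, hlt j (by omega)] at hd
    obtain ⟨i', hi', hn, hl'⟩ := inc_ev (x := x) (d := d) i
    have hpow : i.toNat + 1 < 2 ^ (j + 1) := by
      rw [hi]; exact Nat.lt_two_pow_self
    have hr := ih (j + 1) i' (by omega) (by omega) (hl' _ (by omega) hpow)
    refine (Ev.case_cons (.var rfl) (.case_nil hd (.call rfl (.cons (.call rfl (.var rfl) hi')
      (.cons .nil (.var rfl))) hr))).le ?_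
    rw [Nat.succ_mul (k + 1)]
    omega

/-- The first digit `1` of `ε` determines a power of two between `1 / ε` and `2 / ε`. -/
theorem exists_first_digit {ε : ℝ} (h₀ : 0 < ε) (h₁ : ε < 1 / 2) :
    ∃ J : ℕ, binaryDigit ε J = true ∧ (∀ j < J, binaryDigit ε j = false) ∧
      1 ≤ ε * 2 ^ (J + 1) ∧ ε * 2 ^ (J + 1) < 2 := by
  have hex : ∃ j : ℕ, 1 ≤ ε * 2 ^ (j + 1) := by
    obtain ⟨j, hj⟩ := pow_unbounded_of_one_lt (1 / ε) (one_lt_two (α := ℝ))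
    refine ⟨j, ?_⟩
    rw [div_lt_iff₀' h₀] at hj
    rw [pow_succ]
    nlinarith
  classical
  have hJ := Nat.find_spec hex
  have hmin : ∀ j < Nat.find hex, ε * 2 ^ (j + 1) < 1 := fun j hj =>
    not_le.1 (Nat.find_min hex hj)
  generalize Nat.find hex = J at hJ hmin
  have hlt : ε * 2 ^ (J + 1) < 2 := by
    cases J with
    | zero => norm_num; linarith
    | succ J =>
      have := hmin J (by omega)
      rw [pow_succ]; linarith
  refine ⟨J, ?_, fun j hj => ?_, hJ, hlt⟩
  · have : ⌊ε * 2 ^ (J + 1)⌋₊ = 1 := by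
      rw [Nat.floor_eq_iff (by positivity)]
      norm_num
      exact ⟨hJ, hlt⟩
    simp [binaryDigit, this]
  · have : ⌊ε * 2 ^ (j + 1)⌋₊ = 0 := Nat.floor_eq_zero.2 (hmin j hj)
    simp [binaryDigit, this]

/-! ### The whole program -/

/-- A bound for the time of the whole program. -/
def totalTime (K : ℕ) : ℕ :=
  (K + 1) * (20 * K + 60) + 2 * (K * greedyCost K) + (K + 1) * evalCost K +
    mulTime (sumBound K K) + 100

/-- The program outputs the average of `2 ^ (J + 1)` trees, which do not depend on the input `x`;
their deviation has mean square at most `2 ^ (J + 1)`. -/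
theorem main_ev {d : ℕ → Bool} {K J : ℕ} {R : RDT n} (hJ : d J = true)
    (hlt : ∀ j < J, d j = false) (hR : R.descriptionLength ≤ K) (hK : 2 ^ (J + 1) ≤ K) :
    ∃ L : List (RDT n), L.length = 2 ^ (J + 1) ∧
      (∀ x : Fin n → Bool, ∃ v, Ev (padBits x) d [R.encode] Code.main v (totalTime K)
          (2 ^ (J + 1) * R.queryComplexity) ∧
        v.Denotes ((L.map fun T => T.mu x).sum / 2 ^ (J + 1))) ∧
      (𝔼 x, deviation R L x ^ 2) ≤ 2 ^ (J + 1) := by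
  -- the trees are found without queries, so any input serves to define them
  obtain ⟨L, hg, hD, hl, hm⟩ := greedy_ev (x := fun _ => false) (d := d) hR (J + 1) []
    (by simpa using hK) (by simp [Derandomizes])
  rw [List.length_nil, zero_add] at hl
  refine ⟨L, hl, fun x => ?_, by simpa [deviation, Restriction.mean, Restriction.apply] using hm⟩
  have hf := find_ev (x := padBits x) hJ hlt J 0 .nil (by omega) rfl (by simp [Val.len])
  obtain ⟨v, hv, a, b, rfl, hb, hy, -, hbl⟩ := evalSum_ev (d := d) x hR L (by omega) hD
  have hJK : J + 1 < 2 ^ (J + 1) := Nat.lt_two_pow_self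
  have hsum : sumBound L.length K ≤ sumBound K K := by
    unfold sumBound; gcongr; omega
  have hKK : K ≤ sumBound K K := by unfold sumBound; nlinarith
  obtain ⟨c, hc, hcn, -⟩ := mul_ev (x := padBits x) (d := d) (K := sumBound K K) (a := b)
    (b := powVal (J + 1)) (by omega) (by rw [len_powVal]; omega)
  refine ⟨.cons a c, (Ev.letIn (.call rfl (.cons .nil (.cons .nil (.cons .one .nil))) hf)
    (.letIn (.call rfl (.call rfl (.cons (.var rfl) (.cons (.var rfl) .nil))
      (hg.change_input _)) hv) (.case_cons (.var rfl) (.cons (.var rfl)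
        (.call rfl (.cons (.var rfl) (.var rfl)) hc))))).mono ?_ ?_, a, c, rfl, ?_, ?_⟩
  · have h1 : (J + 1) * (20 * J + 60) ≤ (K + 1) * (20 * K + 60) := by
      gcongr <;> omega
    have h2 : 2 ^ (J + 1) * greedyCost K ≤ K * greedyCost K := by gcongr
    have h3 : (L.length + 1) * evalCost K ≤ (K + 1) * evalCost K := by gcongr; omega
    unfold totalTime
    omega
  · rw [hl]; omega
  · rw [hcn, toNat_powVal]; exact mul_ne_zero hb (by positivity)
  · rw [hcn, toNat_powVal, hy]
    push_cast
    rw [div_div]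

/-! ### Polynomial bounds -/

/-- A function on the natural numbers with a polynomial upper bound. -/
def PolyBounded (f : ℕ → ℕ) : Prop := ∃ c k, ∀ K, f K ≤ c * (K + 1) ^ k

namespace PolyBounded

variable {f g : ℕ → ℕ}

theorem const (c : ℕ) : PolyBounded fun _ => c := ⟨c, 0, fun K => by simp⟩

theorem id : PolyBounded fun K => K := ⟨1, 1, fun K => by simp⟩

theorem add (hf : PolyBounded f) (hg : PolyBounded g) : PolyBounded fun K => f K + g K := by
  obtain ⟨c, k, hf⟩ := hf
  obtain ⟨c', k', hg⟩ := hg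
  refine ⟨c + c', k + k', fun K => ?_⟩
  have h1 : (K + 1) ^ k ≤ (K + 1) ^ (k + k') := Nat.pow_le_pow_right (by omega) (by omega)
  have h2 : (K + 1) ^ k' ≤ (K + 1) ^ (k + k') := Nat.pow_le_pow_right (by omega) (by omega)
  rw [add_mul]
  exact add_le_add ((hf K).trans (by gcongr)) ((hg K).trans (by gcongr))

theorem mul (hf : PolyBounded f) (hg : PolyBounded g) : PolyBounded fun K => f K * g K := by
  obtain ⟨c, k, hf⟩ := hf
  obtain ⟨c', k', hg⟩ := hg
  refine ⟨c * c', k + k', fun K => ?_⟩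
  calc f K * g K ≤ (c * (K + 1) ^ k) * (c' * (K + 1) ^ k') := Nat.mul_le_mul (hf K) (hg K)
    _ = _ := by ring

theorem comp (hf : PolyBounded f) (hg : PolyBounded g) : PolyBounded fun K => f (g K) := by
  obtain ⟨c, k, hf⟩ := hf
  obtain ⟨c', k', hg⟩ := hg
  refine ⟨c * (c' + 1) ^ k, k' * k, fun K => ?_⟩
  have h1 : 1 ≤ (K + 1) ^ k' := Nat.one_le_pow _ _ (by omega)
  calc f (g K) ≤ c * (g K + 1) ^ k := hf _
    _ ≤ c * ((c' + 1) * (K + 1) ^ k') ^ k := by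
        gcongr
        have := hg K
        rw [add_mul, one_mul]
        omega
    _ = _ := by rw [mul_pow, pow_mul, mul_assoc]

theorem addTime : PolyBounded QueryDerand.addTime :=
  (id.mul (((const 20).mul id).add (const 60))).add (const 20)

theorem mulTime : PolyBounded QueryDerand.mulTime :=
  (id.mul ((addTime.comp ((const 2).mul id)).add (const 40))).add (const 20)

theorem fracTime : PolyBounded QueryDerand.fracTime :=
  ((((const 3).mul mulTime).add (addTime.comp ((const 2).mul id))).add
    ((const 160).mul id)).add (const 100)

theorem lookupTime : PolyBounded QueryDerand.lookupTime :=
  (id.mul (((const 160).mul id).add (const 200))).add (const 20)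

theorem prodCost : PolyBounded QueryDerand.prodCost := (lookupTime.add fracTime).add (const 200)

theorem pairWeight : PolyBounded QueryDerand.pairWeight :=
  id.mul ((const 1).add (id.mul (const 2)))

theorem pairBound : PolyBounded QueryDerand.pairBound :=
  ((const 3).mul id).mul (id.add (const 1))

theorem sumBound (hf : PolyBounded f) : PolyBounded fun K => QueryDerand.sumBound K (f K) :=
  (const 1).add (id.mul (((const 2).mul hf).add (const 2)))

theorem corrCost : PolyBounded QueryDerand.corrCost :=
  (((const 2).mul (pairWeight.mul (prodCost.comp pairBound))).add
    ((const 2).mul (fracTime.comp (sumBound pairWeight)))).add (const 200)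

theorem resolveCost : PolyBounded QueryDerand.resolveCost :=
  ((lookupTime.add ((const 2).mul ((id.add (const 1)).mul corrCost))).add
    (fracTime.comp (sumBound pairWeight))).add (const 200)

theorem greedyCost : PolyBounded QueryDerand.greedyCost := (id.mul resolveCost).add (const 200)

theorem evalCost : PolyBounded QueryDerand.evalCost :=
  (((const 20).mul id).add (fracTime.comp (sumBound id))).add (const 100)

theorem totalTime : PolyBounded QueryDerand.totalTime :=
  (((((id.add (const 1)).mul (((const 20).mul id).add (const 60))).add
    ((const 2).mul (id.mul greedyCost))).add ((id.add (const 1)).mul evalCost)).add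
      (mulTime.comp (sumBound id))).add (const 100)

end PolyBounded

theorem deviation_eq (R : RDT n) (L : List (RDT n)) (x : Fin n → Bool) :
    deviation R L x = (L.map fun T => T.mu x).sum - L.length * R.mu x := by
  induction L with
  | nil => simp [deviation]
  | cons T L ih =>
    simp only [deviation, List.map_cons, List.sum_cons, List.length_cons] at ih ⊢
    rw [ih]; push_cast; ring

theorem sum_mu_mem (L : List (RDT n)) (x : Fin n → Bool) :
    0 ≤ (L.map fun T => T.mu x).sum ∧ (L.map fun T => T.mu x).sum ≤ L.length := by
  induction L with
  | nil => simp
  | cons T L ih =>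
    have h1 := T.mu_nonneg x
    have h2 := T.mu_le_one x
    simp only [List.map_cons, List.sum_cons, List.length_cons]
    push_cast
    constructor <;> linarith [ih.1, ih.2]

end Trees

end QueryDerand

theorem mainTheorem4 :
    ∃ (P : QueryDerand.Program) (c k : ℕ) (C : ℝ),
      ∀ (n : ℕ) (R : QueryDerand.RDT n) (ε : ℝ), 0 < ε → ε < 1 / 2 →
        ∃ A : (Fin n → Bool) → ℝ,
          (∀ x : Fin n → Bool, ∃ (v : QueryDerand.Val) (t m : ℕ),
            P.RunsOn R ε x v t m ∧
            v.Denotes (A x) ∧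
            0 ≤ A x ∧ A x ≤ 1 ∧
            (t : ℝ) ≤ c * ((R.descriptionLength : ℝ) + (R.queryComplexity : ℝ) + 1 / ε) ^ k ∧
            (m : ℝ) ≤ C * (R.queryComplexity : ℝ) ^ 2 / ε ^ 3) ∧
          (𝔼 x : Fin n → Bool, (A x - R.mean x) ^ 2) ≤ ε := by
  obtain ⟨c, k, htime⟩ := QueryDerand.PolyBounded.totalTime
  refine ⟨⟨QueryDerand.Code.functions, QueryDerand.Code.main⟩, c * 3 ^ k, k, 2, ?_⟩
  intro n R ε h₀ h₁
  obtain ⟨J, hJ, hlt, hlo, hhi⟩ := QueryDerand.exists_first_digit h₀ h₁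
  set t₀ : ℝ := 2 ^ (J + 1) with ht₀
  have ht₀pos : 0 < t₀ := by positivity
  have ht₀' : t₀ ≤ 2 / ε := by rw [le_div_iff₀ h₀]; linarith
  obtain ⟨L, hl, hrun, hdev⟩ := QueryDerand.main_ev (R := R)
    (K := R.descriptionLength + 2 ^ (J + 1)) hJ hlt (Nat.le_add_right _ _) (Nat.le_add_left _ _)
  have hlR : (L.length : ℝ) = t₀ := by rw [hl]; push_cast; rfl
  refine ⟨fun x => (L.map fun T => T.mu x).sum / t₀, fun x => ?_, ?_⟩
  · obtain ⟨v, ⟨t, ht, m, hm, hev⟩, hden⟩ := hrun x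
    have hsum := QueryDerand.sum_mu_mem L x
    rw [hlR] at hsum
    refine ⟨v, t, m, hev, hden, div_nonneg hsum.1 ht₀pos.le, (div_le_one ht₀pos).2 hsum.2, ?_, ?_⟩
    · have hN : (1 : ℝ) ≤ R.descriptionLength := by exact_mod_cast R.descriptionLength_pos
      have hq : (0 : ℝ) ≤ R.queryComplexity := Nat.cast_nonneg _
      have hK : (R.descriptionLength : ℝ) + t₀ + 1 ≤
          3 * (R.descriptionLength + R.queryComplexity + 1 / ε) := by
        have : 2 / ε = 2 * (1 / ε) := by ring
        have h3 : 0 < 1 / ε := by positivity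
        linarith
      have ht' : (t : ℝ) ≤ c * ((R.descriptionLength : ℝ) + t₀ + 1) ^ k := by
        have := ht.trans (htime _)
        have h : ((t : ℕ) : ℝ) ≤ ((c * (R.descriptionLength + 2 ^ (J + 1) + 1) ^ k : ℕ) : ℝ) := by
          exact_mod_cast this
        push_cast at h
        exact h
      calc (t : ℝ) ≤ c * ((R.descriptionLength : ℝ) + t₀ + 1) ^ k := ht'
        _ ≤ c * (3 * ((R.descriptionLength : ℝ) + R.queryComplexity + 1 / ε)) ^ k := by gcongr
        _ = _ := by rw [mul_pow]; push_cast; ring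
    · have hm' : (m : ℝ) ≤ t₀ * R.queryComplexity := by
        have h : ((m : ℕ) : ℝ) ≤ ((2 ^ (J + 1) * R.queryComplexity : ℕ) : ℝ) := by
          exact_mod_cast hm
        push_cast at h
        exact h
      have hq : (R.queryComplexity : ℝ) ≤ (R.queryComplexity : ℝ) ^ 2 := by
        exact_mod_cast Nat.le_self_pow two_ne_zero _
      have hε : ε ^ 3 ≤ ε := by
        have : ε ^ 2 ≤ 1 := by nlinarith
        nlinarith
      calc (m : ℝ) ≤ t₀ * R.queryComplexity := hm'
        _ ≤ 2 / ε * (R.queryComplexity : ℝ) ^ 2 := by gcongr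
        _ = 2 * (R.queryComplexity : ℝ) ^ 2 / ε := by ring
        _ ≤ _ := by gcongr
  · have h : ∀ x, ((L.map fun T => T.mu x).sum / t₀ - R.mean x) ^ 2 =
        (t₀ ^ 2)⁻¹ * QueryDerand.deviation R L x ^ 2 := by
      intro x
      rw [QueryDerand.deviation_eq, hlR, R.mean_eq_mu]
      field_simp
    simp only [h]
    rw [← Finset.mul_expect]
    calc (t₀ ^ 2)⁻¹ * _ ≤ (t₀ ^ 2)⁻¹ * t₀ := by gcongr
      _ = 1 / t₀ := by field_simp
      _ ≤ ε := by rw [div_le_iff₀ ht₀pos]; exact hlo
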